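/- Let $Q(v)=vBv^{T}$, $v=(x,y,z)\in\mathbb{C}^3$ a row vector, be a nondegenerate complex quadratic form with symmetric invertible matrix $B$, and let $\Delta_Q=\sum_{j,k}b^{jk}\partial_j\partial_k$, where $(b^{jk})=B^{-1}$. Let $V(d)$ be the space of homogeneous polynomials of degree $d$ in $\mathbb{C}[x,y,z]$, let $V_Q(d)\subset V(d)$ be the subspace of polynomials divisible by $Q$, and let $Har_Q(d)=V(d)\cap\ker\Delta_Q$. Let $O_Q(3;\mathbb{C})$ be the group of all $U\in GL(3;\mathbb{C})$ with $Q(vU)=Q(v)$ for all $v$, acting on polynomials by $P(v)\mapsto P(vU)$. (1) For every $d\ge 0$, $$V(d)=\bigoplus_{0\le 2k\le d}Q^k\cdot Har_Q(d-2k),$$ and each summand is invariant under $O_Q(3;\mathbb{C})$. There are invertible complex matrices $A$ with $Q(v)=\sum_{i}((vA)_i)^2$ for all $v$. For every such $A$, let $\Upsilon_Q=\{v\in\mathbb{C}^3: Q(v)=1,\ vA\in\mathbb{R}^3\}$, which is the image of the unit sphere $S^2\subset\mathbb{R}^3$ under $A^{-1}$, and let $dm_Q$ be the standard surface measure of $S^2$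 transported to $\Upsilon_Q$ by $A^{-1}$. Then $\langle P,T\rangle=\int_{\Upsilon_Q}P\cdot\overline{T}\,dm_Q$ is a Hermitian inner product on each $V(d)$; the summands above are pairwise orthogonal for it; and a polynomial $P\in V(d)$ lies in $Har_Q(d)$ if and only if $\int_{\Upsilon_Q}P\cdot\overline{T}\,dm_Q=0$ for every $T\in V_Q(d)$. (2) For every $c\in\mathbb{C}$, every polynomial function on the surface $\mathcal{S}=\{Q=c\}\subset\mathbb{C}^3$ is the restriction to $\mathcal{S}$ of a polynomial $P$ (not necessarily homogeneous) with $\Delta_Q(P)=0$. (3) For every $c\in\mathbb{C}$, with $\mathcal{S}=\{Q=c\}$, and all polynomials $M,N\in\mathbb{C}[x,y,z]$, the Dirichlet problem $\Delta_Q(P)=M$, $P|_{\mathcal{S}}=N|_{\mathcal{S}}$ has a unique polynomial solution $P$. (4) For every $P\in V(d)$ there are vectors $\mathbf{u}_{j,k}\in\mathbb{C}^3$ ($0\le 2k\le d$, $1\le j\le d-2k$) and a scalar $a\in\mathbb{C}$ such that $$P=\sum_{0\le 2k\le d}a_k\,Q^{d-k+\frac12}\cdot\nabla_{\mathbf{u}_{1,k}}\nabla_{\mathbf{u}_{2,k}}\cdots\nabla_{\mathbf{u}_{d-2k,k}}\left(Q^{-\frac12}\right),$$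 where $a_k=1$ if $2k<d$ and $a_k=a$ if $2k=d$, and $\nabla_{\mathbf{u}}$ is the directional derivative. The identity holds on every open set of $\mathbb{C}^3$ on which $Q$ has no zeros and $Q^{1/2}$ has a holomorphic branch, for every such branch, with the same $\mathbf{u}_{j,k}$ and $a$. -/

import Mathlib

open MvPolynomial MeasureTheory
open scoped Matrix ComplexConjugate

namespace QHarmonic

/-- Points of `ℂ³`, regarded as row vectors `(x, y, z)`; matrices act on the right. -/
abbrev C3 : Type := Fin 3 → ℂ

/-- The ring `ℂ[x, y, z]`. -/
abbrev Poly : Type := MvPolynomial (Fin 3) ℂ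

/-- The space `V(d)` of homogeneous polynomials of degree `d` (including `0`). -/
noncomputable abbrev V (d : ℕ) : Submodule ℂ Poly := homogeneousSubmodule (Fin 3) ℂ d

/-- The quadratic form `Q(v) = v B vᵀ` as a polynomial, where `B = Q.toMatrix'` is its
symmetric matrix. -/
noncomputable def formPoly (Q : QuadraticForm ℂ C3) : Poly :=
  ∑ i, ∑ j, C (Q.toMatrix' i j) * X i * X j

/-- The operator `Δ_Q = ∑ b^{jk} ∂_j ∂_k`, where `(b^{jk}) = B⁻¹`. -/
noncomputable def laplacian (Q : QuadraticForm ℂ C3) : Poly →ₗ[ℂ] Poly :=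
  ∑ j, ∑ k, (Q.toMatrix')⁻¹ j k • ((pderiv j).toLinearMap ∘ₗ (pderiv k).toLinearMap)

/-- `Har_Q(d)`: the homogeneous polynomials `P` of degree `d` with `Δ_Q P = 0`. -/
noncomputable def Har (Q : QuadraticForm ℂ C3) (d : ℕ) : Submodule ℂ Poly :=
  V d ⊓ LinearMap.ker (laplacian Q)

/-- `V_Q(d)`: the homogeneous polynomials of degree `d` divisible by `Q`. -/
noncomputable def VQ (Q : QuadraticForm ℂ C3) (d : ℕ) : Submodule ℂ Poly :=
  V d ⊓ (Ideal.span {formPoly Q}).restrictScalars ℂ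

/-- `Q^k · Har_Q(d - 2k)`; used only for `2 * k ≤ d`. -/
noncomputable def summand (Q : QuadraticForm ℂ C3) (d k : ℕ) : Submodule ℂ Poly :=
  (Har Q (d - 2 * k)).map (LinearMap.mulLeft ℂ (formPoly Q ^ k))

/-- The surface `{Q = c}` in `ℂ³`. -/
def surface (Q : QuadraticForm ℂ C3) (c : ℂ) : Set C3 := {v | Q v = c}

/-- The group `O_Q(3; ℂ)` of invertible matrices `U` with `Q(vU) = Q(v)`. -/
def orthogonalGroup (Q : QuadraticForm ℂ C3) : Subgroup (GL (Fin 3) ℂ) where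
  carrier := {U | ∀ v : C3, Q (v ᵥ* U.val) = Q v}
  one_mem' := by intro v; simp
  mul_mem' := by
    intro U W hU hW v
    rw [Units.val_mul, ← Matrix.vecMul_vecMul, hW, hU]
  inv_mem' := by
    intro U hU v
    have h := hU (v ᵥ* (U⁻¹).val)
    rw [Matrix.vecMul_vecMul, ← Units.val_mul, inv_mul_cancel, Units.val_one,
      Matrix.vecMul_one] at h
    exact h.symm

/-- The action `P ↦ P((x, y, z) · U)` of matrices on polynomials. -/
noncomputable def substMatrix (U : GL (Fin 3) ℂ) : Poly →ₐ[ℂ] Poly :=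
  aeval fun j => ∑ i, C (U.val i j) * X i

/-- The coordinate change `v' = vA` reduces `Q` to the sum of squares. -/
def ReducesToSquares (Q : QuadraticForm ℂ C3) (A : GL (Fin 3) ℂ) : Prop :=
  ∀ v : C3, Q v = ∑ i, ((v ᵥ* A.val) i) ^ 2

/-- The totally real ellipsoid `Υ_Q`: the points `v` of `{Q = 1}` for which `vA` is real. -/
def ellipsoid (Q : QuadraticForm ℂ C3) (A : GL (Fin 3) ℂ) : Set C3 :=
  {v | v ∈ surface Q 1 ∧ ∀ i, ((v ᵥ* A.val) i).im = 0}

/-- The measure `dm_Q`: the standard surface measure of the unit sphere in `ℝ³`, transported by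
`x' ↦ x' A⁻¹`. It is regarded as a measure on `ℂ³`. -/
noncomputable def ellipsoidMeasure (A : GL (Fin 3) ℂ) : Measure C3 :=
  (volume : Measure (EuclideanSpace ℝ (Fin 3))).toSphere.map
    fun x => (fun i => ((x.val i : ℝ) : ℂ)) ᵥ* (A⁻¹).val

/-- The Hermitian product `∫_{Υ_Q} P · conj T dm_Q`. -/
noncomputable def herm (Q : QuadraticForm ℂ C3) (A : GL (Fin 3) ℂ) (P T : Poly) : ℂ :=
  ∫ v in ellipsoid Q A, eval v P * conj (eval v T) ∂(ellipsoidMeasure A)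

/-- `∇_{u₁} ∇_{u₂} ⋯ ∇_{uₙ} f`, iterated complex directional derivatives. -/
noncomputable def iterDirDeriv : List C3 → (C3 → ℂ) → C3 → ℂ
  | [], f => f
  | u :: us, f => fun v => lineDeriv ℂ (iterDirDeriv us f) v u

/-- `r` is a holomorphic branch of `Q^{1/2}` on the open set `Ω`, on which `Q` has no zeros. -/
structure IsSqrtBranch (Q : QuadraticForm ℂ C3) (Ω : Set C3) (r : C3 → ℂ) : Prop where
  isOpen : IsOpen Ω
  ne_zero : ∀ v ∈ Ω, Q v ≠ 0
  holomorphic : DifferentiableOn ℂ r Ω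
  sq_eq : ∀ v ∈ Ω, r v ^ 2 = Q v

end QHarmonic

namespace QHarmonic

variable {Q : QuadraticForm ℂ C3}

theorem associated_apply_eq_sum (Q : QuadraticForm ℂ C3) (v w : C3) :
    QuadraticMap.associated (R := ℂ) Q v w = ∑ i, ∑ j, v i * Q.toMatrix' i j * w j := by
  conv_lhs => rw [← Matrix.toLinearMap₂'_toMatrix' (R := ℂ) (QuadraticMap.associated (R := ℂ) Q),
    Matrix.toLinearMap₂'_apply]
  refine Finset.sum_congr rfl fun i _ => Finset.sum_congr rfl fun j _ => ?_
  rw [smul_eq_mul, smul_eq_mul, QuadraticForm.toMatrix']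
  ring

theorem eval_formPoly (Q : QuadraticForm ℂ C3) (v : C3) : eval v (formPoly Q) = Q v := by
  rw [← QuadraticMap.associated_eq_self_apply ℂ Q v, associated_apply_eq_sum, formPoly]
  simp only [map_sum, map_mul, eval_C, eval_X]
  exact Finset.sum_congr rfl fun i _ => Finset.sum_congr rfl fun j _ => by ring

theorem isHomogeneous_formPoly (Q : QuadraticForm ℂ C3) : (formPoly Q).IsHomogeneous 2 :=
  IsHomogeneous.sum _ _ _ fun i _ => IsHomogeneous.sum _ _ _ fun j _ =>
    ((isHomogeneous_C_mul_X _ i).mul (isHomogeneous_X ℂ j))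

theorem isUnit_det_toMatrix' (hQ : LinearMap.Nondegenerate (QuadraticMap.associated (R := ℂ) Q)) :
    IsUnit Q.toMatrix'.det := by
  rw [isUnit_iff_ne_zero]
  exact Matrix.nondegenerate_iff_det_ne_zero.1 (LinearMap.nondegenerate_toMatrix₂'_iff.2 hQ)

theorem pderiv_formPoly (Q : QuadraticForm ℂ C3) (k : Fin 3) :
    pderiv k (formPoly Q) = 2 * ∑ i, C (Q.toMatrix' k i) * X i := by
  have hs := (QuadraticForm.isSymm_toMatrix' Q).apply
  fin_cases k <;>
  simp [formPoly, Fin.sum_univ_three, hs 0 1, hs 0 2, hs 1 2, pderiv_X] <;> ring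

theorem laplacian_apply (Q : QuadraticForm ℂ C3) (P : Poly) :
    laplacian Q P = ∑ j, ∑ k, C ((Q.toMatrix')⁻¹ j k) * pderiv j (pderiv k P) := by
  simp [laplacian, smul_eq_C_mul]

theorem inv_toMatrix'_symm (Q : QuadraticForm ℂ C3) (i j : Fin 3) :
    (Q.toMatrix')⁻¹ i j = (Q.toMatrix')⁻¹ j i :=
  ((QuadraticForm.isSymm_toMatrix' Q).inv.apply i j).symm

/-- The bilinear pairing of gradients `∑ b^{jk} ∂_j P ∂_k R`. -/
noncomputable def gradPair (Q : QuadraticForm ℂ C3) (P R : Poly) : Poly :=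
  ∑ j, ∑ k, C ((Q.toMatrix')⁻¹ j k) * pderiv j P * pderiv k R

theorem laplacian_mul (Q : QuadraticForm ℂ C3) (P R : Poly) :
    laplacian Q (P * R) = P * laplacian Q R + R * laplacian Q P + 2 * gradPair Q P R := by
  have hs := inv_toMatrix'_symm Q
  simp only [laplacian_apply, gradPair, Fin.sum_univ_three, pderiv_mul, map_add, hs 1 0, hs 2 0,
    hs 2 1]
  ring

/-- The linear form `v ↦ B(u, v)`. -/
noncomputable def polarPoly (Q : QuadraticForm ℂ C3) (u : C3) : Poly :=
  ∑ i, C ((Q.toMatrix' *ᵥ u) i) * X i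

/-- The directional derivative `∇_u` on polynomials. -/
noncomputable def dirDeriv (u : C3) (P : Poly) : Poly := ∑ i, C (u i) * pderiv i P

theorem gradPair_linear (hB : IsUnit Q.toMatrix'.det) (u : C3) (P R : Poly)
    (h : ∀ j, pderiv j P = C ((Q.toMatrix' *ᵥ u) j)) : gradPair Q P R = dirDeriv u R := by
  have hu : (Q.toMatrix')⁻¹ *ᵥ (Q.toMatrix' *ᵥ u) = u := by
    rw [Matrix.mulVec_mulVec, Matrix.nonsing_inv_mul _ hB, Matrix.one_mulVec]
  have hs := inv_toMatrix'_symm Q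
  rw [gradPair, Finset.sum_comm, dirDeriv]
  refine Finset.sum_congr rfl fun k _ => ?_
  conv_rhs => rw [← hu, Matrix.mulVec, dotProduct, map_sum, Finset.sum_mul]
  refine Finset.sum_congr rfl fun j _ => ?_
  rw [h, hs j k, C_mul]

theorem gradPair_formPoly (hB : IsUnit Q.toMatrix'.det) (R : Poly) :
    gradPair Q (formPoly Q) R = 2 * ∑ i, X i * pderiv i R := by
  have hs := inv_toMatrix'_symm Q
  have hk : ∀ k, ∑ j, C ((Q.toMatrix')⁻¹ j k) * pderiv j (formPoly Q) = 2 * X k := by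
    intro k
    have h1 : ∀ i, ∑ j, (Q.toMatrix')⁻¹ k j * Q.toMatrix' j i = (1 : Matrix _ _ ℂ) k i :=
        fun i => by
      rw [← Matrix.nonsing_inv_mul _ hB, Matrix.mul_apply]
    simp only [pderiv_formPoly, Finset.mul_sum]
    rw [Finset.sum_comm]
    have : ∀ i : Fin 3, ∑ j, C ((Q.toMatrix')⁻¹ j k) * (2 * (C (Q.toMatrix' j i) * X i))
        = 2 * C ((1 : Matrix _ _ ℂ) k i) * (X i : Poly) := fun i => by
      rw [← h1, map_sum, Finset.mul_sum, Finset.sum_mul]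
      refine Finset.sum_congr rfl fun j _ => ?_
      rw [hs j k, C_mul]; ring
    simp only [this]
    simp [Matrix.one_apply]
  rw [gradPair, Finset.sum_comm, Finset.mul_sum]
  refine Finset.sum_congr rfl fun k _ => ?_
  rw [← Finset.sum_mul, hk]; ring

theorem laplacian_formPoly (hB : IsUnit Q.toMatrix'.det) : laplacian Q (formPoly Q) = 6 := by
  have h1 : ∀ i, ∑ j, (Q.toMatrix')⁻¹ i j * Q.toMatrix' j i = 1 := fun i => by
    rw [← Matrix.mul_apply, Matrix.nonsing_inv_mul _ hB, Matrix.one_apply_eq]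
  have h2 : ∀ j k, pderiv j (pderiv k (formPoly Q)) = 2 * C (Q.toMatrix' k j) := fun j k => by
    rw [pderiv_formPoly, pderiv_mul, map_sum]
    have : pderiv j (2 : Poly) = 0 := (pderiv j).map_natCast 2
    simp [this, Pi.single_apply, pderiv_X]
  simp only [laplacian_apply, h2]
  have : ∀ j, ∑ k, C ((Q.toMatrix')⁻¹ j k) * (2 * C (Q.toMatrix' k j)) = (2 : Poly) := fun j => by
    calc _ = ∑ k, 2 * C ((Q.toMatrix')⁻¹ j k * Q.toMatrix' k j) :=
          Finset.sum_congr rfl fun k _ => by rw [C_mul]; ring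
      _ = 2 := by rw [← Finset.mul_sum, ← map_sum, h1, C_1, mul_one]
  simp only [this]
  norm_num

theorem laplacian_formPoly_mul (hB : IsUnit Q.toMatrix'.det) {d : ℕ} {P : Poly}
    (hP : P.IsHomogeneous d) :
    laplacian Q (formPoly Q * P) = formPoly Q * laplacian Q P + ((4 * d + 6 : ℕ) : Poly) * P := by
  rw [laplacian_mul, laplacian_formPoly hB, gradPair_formPoly hB, hP.sum_X_mul_pderiv]
  push_cast
  rw [nsmul_eq_mul]
  ring

theorem isHomogeneous_laplacian (Q : QuadraticForm ℂ C3) {d : ℕ} {P : Poly}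
    (hP : P.IsHomogeneous d) : (laplacian Q P).IsHomogeneous (d - 2) := by
  rw [laplacian_apply]
  exact IsHomogeneous.sum _ _ _ fun i _ => IsHomogeneous.sum _ _ _ fun j _ =>
    (hP.pderiv.pderiv).C_mul _

theorem laplacian_eq_zero_of_lt (Q : QuadraticForm ℂ C3) {d : ℕ} {P : Poly}
    (hP : P.IsHomogeneous d) (hd : d < 2) : laplacian Q P = 0 := by
  rw [laplacian_apply]
  refine Finset.sum_eq_zero fun i _ => Finset.sum_eq_zero fun j _ => ?_
  have h : (pderiv j P).IsHomogeneous 0 := by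
    have := hP.pderiv (i := j)
    rwa [show d - 1 = 0 by omega] at this
  rw [← totalDegree_zero_iff_isHomogeneous, totalDegree_eq_zero_iff_eq_C] at h
  rw [h, pderiv_C, mul_zero]

theorem natCast_mul_cancel {a : ℕ} (ha : 0 < a) (P : Poly) :
    (a : Poly) * (C ((a : ℂ)⁻¹) * P) = P := by
  have : (a : ℂ) ≠ 0 := by exact_mod_cast ha.ne'
  rw [← mul_assoc, ← map_natCast (C : ℂ →+* Poly) a, ← C_mul, mul_inv_cancel₀ this, C_1, one_mul]

theorem eq_zero_of_formPoly_mul_laplacian_add (hB : IsUnit Q.toMatrix'.det) (d : ℕ) :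
    ∀ (a : ℕ), 0 < a → ∀ P : Poly, P.IsHomogeneous d →
      formPoly Q * laplacian Q P + (a : Poly) * P = 0 → P = 0 := by
  induction d using Nat.strong_induction_on with
  | _ d ih =>
    intro a ha P hP h
    have ha0 : (a : Poly) ≠ 0 := by exact_mod_cast ha.ne'
    by_cases hd : d < 2
    · rw [laplacian_eq_zero_of_lt Q hP hd, mul_zero, zero_add] at h
      exact (mul_eq_zero.1 h).resolve_left ha0
    · set R : Poly := -(C ((a : ℂ)⁻¹) * laplacian Q P) with hR
      have hRh : R.IsHomogeneous (d - 2) := ((isHomogeneous_laplacian Q hP).C_mul _).neg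
      have hPR : P = formPoly Q * R := by
        apply mul_left_cancel₀ ha0
        have := natCast_mul_cancel ha (laplacian Q P)
        rw [hR]
        linear_combination h + formPoly Q * this
      by_cases hQ0 : formPoly Q = 0
      · rw [hPR, hQ0, zero_mul]
      have hR0 : R = 0 := by
        refine ih (d - 2) (by omega) (4 * (d - 2) + 6 + a) (by omega) R hRh ?_
        apply mul_left_cancel₀ hQ0
        have h2 := laplacian_formPoly_mul hB hRh
        rw [← hPR] at h2
        rw [h2] at h
        rw [mul_zero, Nat.cast_add]
        linear_combination h - (a : Poly) * hPR
      rw [hPR, hR0, mul_zero]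

theorem exists_formPoly_mul_laplacian_add (hB : IsUnit Q.toMatrix'.det) (d : ℕ) :
    ∀ (a : ℕ), 0 < a → ∀ F : Poly, F.IsHomogeneous d →
      ∃ P : Poly, P.IsHomogeneous d ∧ formPoly Q * laplacian Q P + (a : Poly) * P = F := by
  induction d using Nat.strong_induction_on with
  | _ d ih =>
    intro a ha F hF
    have hac := natCast_mul_cancel ha F
    by_cases hd : d < 2
    · refine ⟨C ((a : ℂ)⁻¹) * F, hF.C_mul _, ?_⟩
      rw [laplacian_eq_zero_of_lt Q (hF.C_mul _) hd, mul_zero, zero_add, hac]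
    · obtain ⟨R, hR, h⟩ := ih (d - 2) (by omega) (4 * (d - 2) + 6 + a) (by omega)
        (-laplacian Q (C ((a : ℂ)⁻¹) * F)) (isHomogeneous_laplacian Q (hF.C_mul _)).neg
      refine ⟨C ((a : ℂ)⁻¹) * F + formPoly Q * R, (hF.C_mul _).add ?_, ?_⟩
      · have := (isHomogeneous_formPoly Q).mul hR
        rwa [show 2 + (d - 2) = d by omega] at this
      · rw [map_add, laplacian_formPoly_mul hB hR]
        rw [Nat.cast_add] at h
        linear_combination formPoly Q * h + hac

theorem eq_zero_of_laplacian_formPoly_mul (hB : IsUnit Q.toMatrix'.det) {d : ℕ} {P : Poly}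
    (hP : P.IsHomogeneous d) (h : laplacian Q (formPoly Q * P) = 0) : P = 0 := by
  rw [laplacian_formPoly_mul hB hP] at h
  exact eq_zero_of_formPoly_mul_laplacian_add hB d _ (by omega) P hP h

theorem exists_laplacian_formPoly_mul (hB : IsUnit Q.toMatrix'.det) {d : ℕ} {F : Poly}
    (hF : F.IsHomogeneous d) :
    ∃ P : Poly, P.IsHomogeneous d ∧ laplacian Q (formPoly Q * P) = F := by
  obtain ⟨P, hP, h⟩ := exists_formPoly_mul_laplacian_add hB d (4 * d + 6) (by omega) F hF
  exact ⟨P, hP, by rw [laplacian_formPoly_mul hB hP, h]⟩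

/-- Every form splits as a harmonic form plus a multiple of `Q`. -/
theorem exists_harmonic_add_formPoly_mul (hB : IsUnit Q.toMatrix'.det) {d : ℕ} {P : Poly}
    (hP : P.IsHomogeneous (d + 2)) :
    ∃ H ∈ Har Q (d + 2), ∃ R : Poly, R.IsHomogeneous d ∧ P = H + formPoly Q * R := by
  obtain ⟨R, hR, h⟩ := exists_laplacian_formPoly_mul hB (isHomogeneous_laplacian Q hP)
  rw [show d + 2 - 2 = d by omega] at hR
  refine ⟨P - formPoly Q * R, ⟨?_, ?_⟩, R, hR, by ring⟩
  · have := (isHomogeneous_formPoly Q).mul hR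
    rw [add_comm] at this
    exact hP.sub this
  · simp [h]

theorem homogeneousComponent_mul_of_isHomogeneous {F : Poly} {n : ℕ} (hF : F.IsHomogeneous n)
    (m : ℕ) (S : Poly) :
    homogeneousComponent (n + m) (F * S) = F * homogeneousComponent m S := by
  conv_lhs => rw [← sum_homogeneousComponent S, Finset.mul_sum, map_sum]
  conv_rhs => rw [← sum_homogeneousComponent S, map_sum, Finset.mul_sum]
  refine Finset.sum_congr rfl fun i _ => ?_
  have hi := homogeneousComponent_isHomogeneous i S
  rw [homogeneousComponent_of_mem (hF.mul hi), homogeneousComponent_of_mem hi]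
  by_cases h : m = i
  · simp [h]
  · rw [if_neg h, if_neg (by omega), mul_zero]

theorem homogeneousComponent_laplacian (Q : QuadraticForm ℂ C3) (m : ℕ) (S : Poly) :
    homogeneousComponent m (laplacian Q S) = laplacian Q (homogeneousComponent (m + 2) S) := by
  conv_lhs => rw [← sum_homogeneousComponent S, map_sum, map_sum]
  conv_rhs => rw [← sum_homogeneousComponent S, map_sum, map_sum]
  refine Finset.sum_congr rfl fun i _ => ?_
  have hi := homogeneousComponent_isHomogeneous i S
  rw [homogeneousComponent_of_mem (isHomogeneous_laplacian Q hi), homogeneousComponent_of_mem hi]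
  by_cases h : i < 2
  · rw [laplacian_eq_zero_of_lt Q hi h, ite_self, if_neg (by omega), map_zero]
  · by_cases h' : m = i - 2
    · rw [if_pos h', if_pos (by omega)]
    · rw [if_neg h', if_neg (by omega), map_zero]

theorem exists_homogeneous_of_formPoly_dvd {d : ℕ} {P : Poly} (hP : P.IsHomogeneous (d + 2))
    (h : formPoly Q ∣ P) : ∃ R : Poly, R.IsHomogeneous d ∧ P = formPoly Q * R := by
  obtain ⟨S, rfl⟩ := h
  refine ⟨homogeneousComponent d S, homogeneousComponent_isHomogeneous d S, ?_⟩
  rw [← homogeneousComponent_mul_of_isHomogeneous (isHomogeneous_formPoly Q), add_comm 2 d,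
    homogeneousComponent_eq_self hP]

theorem eq_zero_of_formPoly_dvd_of_lt {d : ℕ} {P : Poly} (hP : P.IsHomogeneous d) (hd : d < 2)
    (h : formPoly Q ∣ P) : P = 0 := by
  by_contra hP0
  obtain ⟨S, rfl⟩ := h
  have h1 := hP.totalDegree hP0
  rw [totalDegree_mul_of_isDomain (left_ne_zero_of_mul hP0) (right_ne_zero_of_mul hP0),
    (isHomogeneous_formPoly Q).totalDegree (left_ne_zero_of_mul hP0)] at h1
  omega

/-- A harmonic form divisible by `Q` vanishes. -/
theorem eq_zero_of_mem_Har_of_formPoly_dvd (hB : IsUnit Q.toMatrix'.det) {d : ℕ} {P : Poly}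
    (hP : P ∈ Har Q d) (h : formPoly Q ∣ P) : P = 0 := by
  have hPd : P.IsHomogeneous d := hP.1
  obtain hd | ⟨e, rfl⟩ : d < 2 ∨ ∃ e, d = e + 2 := by
    by_cases hd : d < 2
    · exact Or.inl hd
    · exact Or.inr ⟨d - 2, by omega⟩
  · exact eq_zero_of_formPoly_dvd_of_lt hPd hd h
  · obtain ⟨R, hR, rfl⟩ := exists_homogeneous_of_formPoly_dvd hPd h
    rw [eq_zero_of_laplacian_formPoly_mul hB hR hP.2, mul_zero]

theorem exists_laplacian_sub_C_mul (hB : IsUnit Q.toMatrix'.det) (c : ℂ) (F : Poly) :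
    ∃ R : Poly, laplacian Q ((formPoly Q - C c) * R) = F := by
  set T : Poly →ₗ[ℂ] Poly := laplacian Q ∘ₗ LinearMap.mulLeft ℂ (formPoly Q - C c)
  have key : ∀ d, ∀ F : Poly, F.IsHomogeneous d → F ∈ LinearMap.range T := by
    intro d
    induction d using Nat.strong_induction_on with
    | _ d ih =>
      intro F hF
      obtain ⟨R, hR, h⟩ := exists_laplacian_formPoly_mul hB hF
      have hTR : T R = F - c • laplacian Q R := by
        simp [T, sub_mul, ← h, ← smul_eq_C_mul]
      have hL : laplacian Q R ∈ LinearMap.range T := by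
        by_cases hd : d < 2
        · rw [laplacian_eq_zero_of_lt Q hR hd]; exact zero_mem _
        · exact ih (d - 2) (by omega) _ (isHomogeneous_laplacian Q hR)
      have : F = T R + c • laplacian Q R := by rw [hTR]; ring
      rw [this]
      exact add_mem (LinearMap.mem_range_self _ _) (Submodule.smul_mem _ _ hL)
  have : F ∈ LinearMap.range T := by
    rw [← sum_homogeneousComponent F]
    exact Submodule.sum_mem _ fun i _ => key i _ (homogeneousComponent_isHomogeneous i F)
  exact this

theorem eq_zero_of_laplacian_sub_C_mul (hB : IsUnit Q.toMatrix'.det) (c : ℂ) (R : Poly)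
    (h : laplacian Q ((formPoly Q - C c) * R) = 0) : R = 0 := by
  have h' : laplacian Q (formPoly Q * R) = c • laplacian Q R := by
    rw [sub_mul, map_sub, ← smul_eq_C_mul, map_smul, sub_eq_zero] at h
    exact h
  have key : ∀ n, (∀ d, n ≤ d → homogeneousComponent d R = 0) →
      ∀ d, homogeneousComponent d R = 0 := by
    intro n
    induction n with
    | zero => exact fun h d => h d (Nat.zero_le d)
    | succ n ih =>
      intro hn
      refine ih fun d hd => ?_
      rcases hd.eq_or_lt with rfl | hd
      · have h1 := congrArg (homogeneousComponent n) h'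
        rw [map_smul, homogeneousComponent_laplacian, homogeneousComponent_laplacian,
          hn (n + 2) (by omega), map_zero, smul_zero, add_comm n 2,
          homogeneousComponent_mul_of_isHomogeneous (isHomogeneous_formPoly Q)] at h1
        exact eq_zero_of_laplacian_formPoly_mul hB (homogeneousComponent_isHomogeneous n R) h1
      · exact hn d hd
  have := key (R.totalDegree + 1) fun d hd => homogeneousComponent_eq_zero _ _ (by omega)
  rw [← sum_homogeneousComponent R]
  exact Finset.sum_eq_zero fun i _ => this i

/-- The harmonic expansion `P = ∑ Q^k h_k` of a form. -/
theorem exists_harmonic_expansion (hB : IsUnit Q.toMatrix'.det) (d : ℕ) :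
    ∀ P : Poly, P.IsHomogeneous d → ∃ h : ℕ → Poly, (∀ k, h k ∈ Har Q (d - 2 * k)) ∧
      P = ∑ k ∈ Finset.range (d / 2 + 1), formPoly Q ^ k * h k := by
  induction d using Nat.strong_induction_on with
  | _ d ih =>
    intro P hP
    obtain hd | ⟨e, rfl⟩ : d < 2 ∨ ∃ e, d = e + 2 := by
      by_cases hd : d < 2
      · exact Or.inl hd
      · exact Or.inr ⟨d - 2, by omega⟩
    · refine ⟨fun k => if k = 0 then P else 0, fun k => ?_, ?_⟩
      · by_cases hk : k = 0
        · simp only [hk, if_true]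
          exact ⟨hP, laplacian_eq_zero_of_lt Q hP hd⟩
        · simp only [hk, if_false]; exact zero_mem _
      · rw [show d / 2 + 1 = 1 by omega]; simp
    · obtain ⟨H, hH, R, hR, rfl⟩ := exists_harmonic_add_formPoly_mul hB hP
      obtain ⟨h, hh, rfl⟩ := ih e (by omega) R hR
      refine ⟨fun k => Nat.casesOn k H h, fun k => ?_, ?_⟩
      · cases k with
        | zero => exact hH
        | succ k =>
          have := hh k
          rwa [show e - 2 * k = e + 2 - 2 * (k + 1) by omega] at this
      · rw [show (e + 2) / 2 + 1 = (e / 2 + 1) + 1 by omega, Finset.sum_range_succ' _ (e / 2 + 1),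
          add_comm, Finset.mul_sum]
        simp only [pow_zero, one_mul]
        congr 1
        exact Finset.sum_congr rfl fun k _ => by ring

theorem harmonic_expansion_unique (hB : IsUnit Q.toMatrix'.det) (hQ0 : formPoly Q ≠ 0) (n : ℕ) :
    ∀ (h : ℕ → Poly), (∀ k, ∃ m, h k ∈ Har Q m) →
      ∑ k ∈ Finset.range n, formPoly Q ^ k * h k = 0 → ∀ k < n, h k = 0 := by
  induction n with
  | zero => intro h _ _ k hk; omega
  | succ n ih =>
    intro h hh hs
    rw [Finset.sum_range_succ', pow_zero, one_mul] at hs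
    have hs' : ∑ k ∈ Finset.range n, formPoly Q ^ (k + 1) * h (k + 1) =
        formPoly Q * ∑ k ∈ Finset.range n, formPoly Q ^ k * h (k + 1) := by
      rw [Finset.mul_sum]
      exact Finset.sum_congr rfl fun k _ => by ring
    rw [hs'] at hs
    obtain ⟨m, hm⟩ := hh 0
    have h0 : h 0 = 0 := by
      refine eq_zero_of_mem_Har_of_formPoly_dvd hB hm
        ⟨-∑ k ∈ Finset.range n, formPoly Q ^ k * h (k + 1), ?_⟩
      linear_combination hs
    rw [h0, add_zero] at hs
    have := ih (fun k => h (k + 1)) (fun k => hh (k + 1)) ((mul_eq_zero.1 hs).resolve_left hQ0)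
    intro k hk
    cases k with
    | zero => exact h0
    | succ k => exact this k (by omega)

theorem formPoly_ne_zero (hB : IsUnit Q.toMatrix'.det) : formPoly Q ≠ 0 := by
  intro h
  have := laplacian_formPoly hB
  rw [h, map_zero] at this
  exact absurd this (by norm_num)

theorem summand_le_V (Q : QuadraticForm ℂ C3) {d k : ℕ} (hk : 2 * k ≤ d) :
    summand Q d k ≤ V d := by
  rintro _ ⟨h, hh, rfl⟩
  have := ((isHomogeneous_formPoly Q).pow k).mul (show h.IsHomogeneous _ from hh.1)
  rw [show 2 * k + (d - 2 * k) = d by omega] at this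
  exact this

theorem iSup_summand (hB : IsUnit Q.toMatrix'.det) (d : ℕ) :
    (⨆ k : Fin (d / 2 + 1), summand Q d k) = V d := by
  refine le_antisymm (iSup_le fun k => summand_le_V Q (by omega)) fun P hP => ?_
  obtain ⟨h, hh, rfl⟩ := exists_harmonic_expansion hB d P hP
  refine Submodule.sum_mem _ fun k hk => ?_
  exact Submodule.mem_iSup_of_mem (p := fun k : Fin (d / 2 + 1) => summand Q d k)
    ⟨k, Finset.mem_range.1 hk⟩ ⟨h k, hh k, rfl⟩

theorem iSupIndep_summand (hB : IsUnit Q.toMatrix'.det) (d : ℕ) :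
    iSupIndep (fun k : Fin (d / 2 + 1) => summand Q d k) := by
  apply iSupIndep_of_dfinsupp_lsum_injective
  rw [injective_iff_map_eq_zero]
  intro f hf
  rw [DFinsupp.lsum_apply_apply, DFinsupp.sumAddHom_apply, DFinsupp.sum_eq_sum_fintype _ (by simp)]
    at hf
  choose h hh hfh using fun k => (f k).2
  have hs : ∑ k ∈ Finset.range (d / 2 + 1), formPoly Q ^ k *
      (if hk : k < d / 2 + 1 then h ⟨k, hk⟩ else 0) = 0 := by
    rw [Finset.sum_range, ← hf]
    refine Finset.sum_congr rfl fun k _ => ?_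
    rw [dif_pos k.2]
    exact hfh k
  have h0 := harmonic_expansion_unique hB (formPoly_ne_zero hB) _ _ (fun k => ?_) hs
  · ext1 k
    apply Subtype.ext
    have := h0 k k.2
    rw [dif_pos k.2] at this
    rw [← hfh k, show h k = 0 from this]
    simp
  · by_cases hk : k < d / 2 + 1
    · rw [dif_pos hk]; exact ⟨_, hh ⟨k, hk⟩⟩
    · rw [dif_neg hk]; exact ⟨0, zero_mem _⟩

theorem eval_substMatrix (U : GL (Fin 3) ℂ) (P : Poly) (v : C3) :
    eval v (substMatrix U P) = eval (v ᵥ* U.val) P := by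
  have : (aeval v : Poly →ₐ[ℂ] ℂ).comp (substMatrix U) = aeval (v ᵥ* U.val) := by
    ext j
    simp [substMatrix, Matrix.vecMul, dotProduct, mul_comm]
  have h := DFunLike.congr_fun this P
  simpa [coe_aeval_eq_eval] using h

theorem substMatrix_mul (U W : GL (Fin 3) ℂ) (P : Poly) :
    substMatrix (U * W) P = substMatrix U (substMatrix W P) := by
  refine MvPolynomial.funext fun v => ?_
  rw [eval_substMatrix, eval_substMatrix, eval_substMatrix, Units.val_mul, Matrix.vecMul_vecMul]

theorem substMatrix_one (P : Poly) : substMatrix 1 P = P :=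
  MvPolynomial.funext fun v => by rw [eval_substMatrix, Units.val_one, Matrix.vecMul_one]

theorem substMatrix_apply_inv (U : GL (Fin 3) ℂ) (P : Poly) :
    substMatrix U (substMatrix U⁻¹ P) = P := by
  rw [← substMatrix_mul, mul_inv_cancel, substMatrix_one]

theorem isHomogeneous_substMatrix (U : GL (Fin 3) ℂ) {P : Poly} {d : ℕ}
    (hP : P.IsHomogeneous d) : (substMatrix U P).IsHomogeneous d := by
  have := hP.aeval (fun j => ∑ i, C (U.val i j) * X i) (n := 1)
    fun j => IsHomogeneous.sum _ _ _ fun i _ => isHomogeneous_C_mul_X _ i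
  rwa [one_mul] at this

theorem substMatrix_formPoly {Q₁ Q₂ : QuadraticForm ℂ C3} {U : GL (Fin 3) ℂ}
    (h : ∀ v, Q₂ (v ᵥ* U.val) = Q₁ v) : substMatrix U (formPoly Q₂) = formPoly Q₁ :=
  MvPolynomial.funext fun v => by
    rw [eval_substMatrix, eval_formPoly, eval_formPoly, h]

theorem toMatrix'_eq_of_isometry {Q₁ Q₂ : QuadraticForm ℂ C3} {U : GL (Fin 3) ℂ}
    (h : ∀ v, Q₂ (v ᵥ* U.val) = Q₁ v) : Q₁.toMatrix' = U.val * Q₂.toMatrix' * U.valᵀ := by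
  have : Q₁ = Q₂.comp (Matrix.toLin' U.valᵀ) := by
    ext v
    rw [QuadraticMap.comp_apply, Matrix.toLin'_apply, Matrix.mulVec_transpose, h]
  rw [this, QuadraticForm.toMatrix'_comp, LinearMap.toMatrix'_toLin', Matrix.transpose_transpose]

theorem pderiv_substMatrix (U : GL (Fin 3) ℂ) (i : Fin 3) (P : Poly) :
    pderiv i (substMatrix U P) = ∑ j, C (U.val i j) * substMatrix U (pderiv j P) := by
  induction P using MvPolynomial.induction_on with
  | C a => simp [substMatrix]
  | add p q hp hq => simp only [map_add, hp, hq, mul_add, Finset.sum_add_distrib]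
  | mul_X p k hp =>
    have hX : pderiv i (substMatrix U (X k)) = C (U.val i k) := by
      simp [substMatrix, pderiv_X, Pi.single_apply]
    rw [map_mul, pderiv_mul, hp, hX]
    have : ∀ j, substMatrix U (pderiv j (p * X k)) =
        substMatrix U (pderiv j p) * substMatrix U (X k) +
          substMatrix U p * (if k = j then 1 else 0) := fun j => by
      rw [pderiv_mul, pderiv_X, map_add, map_mul, map_mul, Pi.single_apply]
      split_ifs <;> simp
    simp only [this, mul_add, Finset.sum_add_distrib, Finset.sum_mul, mul_ite, mul_one, mul_zero,
      Finset.sum_ite_eq, Finset.mem_univ, if_true]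
    rw [mul_comm (C _) (substMatrix U p)]
    simp only [mul_assoc]

theorem laplacian_substMatrix {Q₁ Q₂ : QuadraticForm ℂ C3} {U : GL (Fin 3) ℂ}
    (h : ∀ v, Q₂ (v ᵥ* U.val) = Q₁ v) (P : Poly) :
    laplacian Q₁ (substMatrix U P) = substMatrix U (laplacian Q₂ P) := by
  have hU : IsUnit U.val.det := (Matrix.isUnit_iff_isUnit_det _).1 U.isUnit
  have hUt : IsUnit U.valᵀ.det := by rwa [Matrix.det_transpose]
  have hinv : U.valᵀ * (Q₁.toMatrix')⁻¹ * U.val = (Q₂.toMatrix')⁻¹ := by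
    rw [toMatrix'_eq_of_isometry h, Matrix.mul_inv_rev, Matrix.mul_inv_rev, ← mul_assoc,
      Matrix.mul_nonsing_inv _ hUt, one_mul, mul_assoc, Matrix.nonsing_inv_mul _ hU, mul_one]
  have he : ∀ a b, (Q₂.toMatrix')⁻¹ a b =
      ∑ k, ∑ j, U.val j a * (Q₁.toMatrix')⁻¹ j k * U.val k b := fun a b => by
    rw [← hinv, Matrix.mul_apply]
    refine Finset.sum_congr rfl fun k _ => ?_
    rw [Matrix.mul_apply, Finset.sum_mul]
    rfl
  have hd : ∀ j k, pderiv j (pderiv k (substMatrix U P)) = ∑ b, ∑ a, C (U.val k b * U.val j a) *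
      substMatrix U (pderiv a (pderiv b P)) := fun j k => by
    rw [pderiv_substMatrix, map_sum]
    refine Finset.sum_congr rfl fun b _ => ?_
    rw [pderiv_C_mul, pderiv_substMatrix, Finset.mul_sum]
    exact Finset.sum_congr rfl fun a _ => by rw [C_mul]; ring
  have hr : substMatrix U (laplacian Q₂ P) = ∑ a, ∑ b, C ((Q₂.toMatrix')⁻¹ a b) *
      substMatrix U (pderiv a (pderiv b P)) := by
    simp only [laplacian_apply, map_sum, map_mul]
    refine Finset.sum_congr rfl fun a _ => Finset.sum_congr rfl fun b _ => ?_
    congr 1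
    exact (substMatrix U).commutes _
  rw [hr, laplacian_apply]
  simp only [hd, he]
  simp only [C_mul, map_add, Fin.sum_univ_three]
  ring

theorem mem_Har_substMatrix {Q₁ Q₂ : QuadraticForm ℂ C3} {U : GL (Fin 3) ℂ}
    (h : ∀ v, Q₂ (v ᵥ* U.val) = Q₁ v) {d : ℕ} {P : Poly} (hP : P ∈ Har Q₂ d) :
    substMatrix U P ∈ Har Q₁ d := by
  refine ⟨isHomogeneous_substMatrix U hP.1, ?_⟩
  have hP' : laplacian Q₂ P = 0 := hP.2
  change laplacian Q₁ _ = 0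
  rw [laplacian_substMatrix h, hP', map_zero]

theorem map_summand_le {U : GL (Fin 3) ℂ} (hU : U ∈ orthogonalGroup Q) (d k : ℕ) :
    (summand Q d k).map (substMatrix U).toLinearMap ≤ summand Q d k := by
  rintro _ ⟨_, ⟨h, hh, rfl⟩, rfl⟩
  refine ⟨substMatrix U h, mem_Har_substMatrix hU hh, ?_⟩
  simp [substMatrix_formPoly hU]

theorem map_summand {U : GL (Fin 3) ℂ} (hU : U ∈ orthogonalGroup Q) (d k : ℕ) :
    (summand Q d k).map (substMatrix U).toLinearMap = summand Q d k := by
  refine le_antisymm (map_summand_le hU d k) fun P hP => ?_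
  exact ⟨substMatrix U⁻¹ P, map_summand_le (inv_mem hU) d k ⟨P, hP, rfl⟩,
    substMatrix_apply_inv U P⟩

/-- The sum of three squares. -/
noncomputable abbrev sumSq : QuadraticForm ℂ C3 :=
  QuadraticMap.weightedSumSquares ℂ (1 : Fin 3 → ℂ)

theorem sumSq_apply (v : C3) : sumSq v = ∑ i, v i ^ 2 := by
  simp [QuadraticMap.weightedSumSquares_apply, sq]

theorem formPoly_sumSq : formPoly sumSq = ∑ i, X i ^ 2 :=
  MvPolynomial.funext fun v => by rw [eval_formPoly, sumSq_apply]; simp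

theorem ReducesToSquares.isometry {A : GL (Fin 3) ℂ} (h : ReducesToSquares Q A) (v : C3) :
    sumSq (v ᵥ* A.val) = Q v := by rw [h v, sumSq_apply]

theorem ReducesToSquares.isometry_inv {A : GL (Fin 3) ℂ} (h : ReducesToSquares Q A) (v : C3) :
    Q (v ᵥ* (A⁻¹).val) = sumSq v := by
  rw [← h.isometry, Matrix.vecMul_vecMul, ← Units.val_mul, inv_mul_cancel, Units.val_one,
    Matrix.vecMul_one]

theorem toMatrix'_sumSq : sumSq.toMatrix' = 1 := by
  ext i j
  rw [QuadraticForm.toMatrix', LinearMap.toMatrix₂'_apply, QuadraticMap.associated_apply,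
    sumSq_apply, sumSq_apply, sumSq_apply]
  fin_cases i <;> fin_cases j <;> simp [Fin.sum_univ_three] <;> norm_num

theorem exists_reducesToSquares
    (hQ : LinearMap.Nondegenerate (QuadraticMap.associated (R := ℂ) Q)) :
    ∃ A : GL (Fin 3) ℂ, ReducesToSquares Q A := by
  have h := QuadraticForm.equivalent_weightedSumSquares_of_isAlgClosed Q hQ.1
  rw [Module.finrank_fin_fun] at h
  obtain ⟨e⟩ := h
  set f : C3 ≃ₗ[ℂ] C3 := e.toLinearEquiv
  refine ⟨⟨(LinearMap.toMatrix' f.toLinearMap)ᵀ, (LinearMap.toMatrix' f.symm.toLinearMap)ᵀ, ?_, ?_⟩,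
    fun v => ?_⟩
  · rw [← Matrix.transpose_mul, ← LinearMap.toMatrix'_comp]; simp
  · rw [← Matrix.transpose_mul, ← LinearMap.toMatrix'_comp]; simp
  · rw [Matrix.vecMul_transpose, LinearMap.toMatrix'_mulVec, ← sumSq_apply]
    exact (e.map_app v).symm

/-- A polynomial vanishing on `{x² + y² + z² = c}` outside the zeros of a nonzero polynomial
`g(y, z)` is divisible by `x² + y² + z² - c`. -/
theorem sumSq_sub_C_dvd (c : ℂ) {g : MvPolynomial (Fin 2) ℂ} (hg : g ≠ 0) {P : Poly}
    (h : ∀ (x : ℂ) (w : Fin 2 → ℂ), sumSq (Fin.cons x w : C3) = c → eval w g ≠ 0 →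
      eval (Fin.cons x w : C3) P = 0) :
    formPoly sumSq - C c ∣ P := by
  set q : MvPolynomial (Fin 2) ℂ := X 0 ^ 2 + X 1 ^ 2 - C c with hq
  set D : Polynomial (MvPolynomial (Fin 2) ℂ) := Polynomial.X ^ 2 + Polynomial.C q with hD
  have hΦ : finSuccEquiv ℂ 2 (formPoly sumSq - C c) = D := by
    have h1 : finSuccEquiv ℂ 2 (X 1) = Polynomial.C (X 0) := finSuccEquiv_X_succ (j := 0)
    have h2 : finSuccEquiv ℂ 2 (X 2) = Polynomial.C (X 1) := finSuccEquiv_X_succ (j := 1)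
    have h3 : finSuccEquiv ℂ 2 (C c) = Polynomial.C (C c) := by
      simpa using (finSuccEquiv ℂ 2).commutes c
    rw [formPoly_sumSq, Fin.sum_univ_three, map_sub, map_add, map_add, map_pow, map_pow, map_pow,
      finSuccEquiv_X_zero, h1, h2, h3, hD, hq]
    simp only [map_sub, map_add, map_pow]
    ring
  have hDm : D.Monic := Polynomial.monic_X_pow_add_C q two_ne_zero
  have hdeg : D.natDegree = 2 := Polynomial.natDegree_X_pow_add_C
  have hq0 : q ≠ 0 := by
    obtain ⟨t, ht⟩ := IsAlgClosed.exists_pow_nat_eq (c + 1) (n := 2) (by norm_num)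
    intro h0
    have := congrArg (eval ![t, 0]) h0
    simp [hq, ht] at this
  set r := finSuccEquiv ℂ 2 P %ₘ D with hr
  obtain ⟨b, a, hba⟩ := Polynomial.exists_eq_X_add_C_of_natDegree_le_one (p := r) (by
    have := Polynomial.natDegree_modByMonic_lt (finSuccEquiv ℂ 2 P) hDm (by
      intro h1; rw [h1] at hdeg; simp at hdeg)
    change _ < _ at this
    rw [← hr] at this
    omega)
  have hval : ∀ (x : ℂ) (w : Fin 2 → ℂ), x ^ 2 = -eval w q →
      eval (Fin.cons x w : C3) P = eval w b * x + eval w a := by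
    intro x w hx
    rw [eval_eq_eval_mv_eval', ← Polynomial.modByMonic_add_div (finSuccEquiv ℂ 2 P) D, ← hr, hba]
    simp [hD, hx]
  have hsurf : ∀ (x : ℂ) (w : Fin 2 → ℂ), x ^ 2 = -eval w q → sumSq (Fin.cons x w : C3) = c := by
    intro x w hx
    rw [sumSq_apply, Fin.sum_univ_succ, Fin.sum_univ_two]
    simp only [Fin.cons_zero, Fin.cons_succ, hx, hq]
    simp
  have hab : ∀ w, eval w g ≠ 0 → eval w a = 0 ∧ eval w b * eval w q = 0 := by
    intro w hw
    obtain ⟨x, hx⟩ := IsAlgClosed.exists_pow_nat_eq (-eval w q) (n := 2) (by norm_num)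
    have hx' : (-x) ^ 2 = -eval w q := by rw [neg_sq, hx]
    have e1 := h x w (hsurf x w hx) hw
    have e2 := h (-x) w (hsurf _ w hx') hw
    rw [hval _ _ hx] at e1
    rw [hval _ _ hx'] at e2
    have e3 : eval w b * x = 0 := by linear_combination (e1 - e2) / 2
    exact ⟨by linear_combination (e1 + e2) / 2, by linear_combination eval w b * hx - x * e3⟩
  have ha : a = 0 := by
    have : a * g = 0 := MvPolynomial.funext fun w => by
      by_cases hw : eval w g = 0
      · simp [hw]
      · simp [(hab w hw).1]
    exact (mul_eq_zero.1 this).resolve_right hg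
  have hb : b = 0 := by
    have : b * q * g = 0 := MvPolynomial.funext fun w => by
      by_cases hw : eval w g = 0
      · simp [hw]
      · rw [map_mul, map_mul, (hab w hw).2]; simp
    exact (mul_eq_zero.1 ((mul_eq_zero.1 this).resolve_right hg)).resolve_right hq0
  have hr0 : r = 0 := by rw [hba, ha, hb]; simp
  have hdvd : D ∣ finSuccEquiv ℂ 2 P := (Polynomial.modByMonic_eq_zero_iff_dvd hDm).1 hr0
  rwa [← hΦ, map_dvd_iff] at hdvd

/-- A polynomial vanishing on `{Q = c}` is divisible by `Q - c`. -/
theorem formPoly_sub_C_dvd {A : GL (Fin 3) ℂ} (hA : ReducesToSquares Q A) {c : ℂ} {P : Poly}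
    (h : ∀ v ∈ surface Q c, eval v P = 0) : formPoly Q - C c ∣ P := by
  have h1 : formPoly sumSq - C c ∣ substMatrix A⁻¹ P := by
    refine sumSq_sub_C_dvd c one_ne_zero fun x w hxw _ => ?_
    rw [eval_substMatrix]
    exact h _ (by rw [surface, Set.mem_ofPred, hA.isometry_inv, hxw])
  have h2 := map_dvd (substMatrix A) h1
  rwa [substMatrix_apply_inv, map_sub, substMatrix_formPoly hA.isometry,
    show substMatrix A (C c) = C c from (substMatrix A).commutes c] at h2

theorem existsUnique_dirichlet (hB : IsUnit Q.toMatrix'.det) {A : GL (Fin 3) ℂ}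
    (hA : ReducesToSquares Q A) (c : ℂ) (M N : Poly) :
    ∃! P : Poly, laplacian Q P = M ∧ ∀ v ∈ surface Q c, eval v P = eval v N := by
  obtain ⟨R, hR⟩ := exists_laplacian_sub_C_mul hB c (M - laplacian Q N)
  refine ⟨N + (formPoly Q - C c) * R, ⟨by rw [map_add, hR]; ring, fun v hv => ?_⟩, ?_⟩
  · have hv' : Q v = c := hv
    simp [eval_formPoly, hv']
  · rintro P ⟨hP, hPN⟩
    obtain ⟨S, hS⟩ : formPoly Q - C c ∣ P - (N + (formPoly Q - C c) * R) :=
      formPoly_sub_C_dvd hA fun v hv => by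
        have hv' : Q v = c := hv
        simp [hPN v hv, eval_formPoly, hv']
    have hS0 : S = 0 := by
      apply eq_zero_of_laplacian_sub_C_mul hB c
      rw [← hS, map_sub, map_add, hR, hP]; ring
    rw [hS0, mul_zero, sub_eq_zero] at hS
    exact hS

/-- A complex polynomial of degree at most `2n + 2` is a product of `n + 1` polynomials of degree
at most two. -/
theorem exists_prod_quadratics (n : ℕ) :
    ∀ p : Polynomial ℂ, p.natDegree ≤ 2 * (n + 1) →
      ∃ q : Fin (n + 1) → Polynomial ℂ, (∀ i, (q i).natDegree ≤ 2) ∧ p = ∏ i, q i := by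
  induction n with
  | zero => exact fun p hp => ⟨fun _ => p, fun _ => by simpa using hp, by simp⟩
  | succ n ih =>
    intro p hp
    suffices H : ∃ s t : Polynomial ℂ, s.natDegree ≤ 2 ∧ t.natDegree ≤ 2 * (n + 1) ∧ p = s * t by
      obtain ⟨s, t, hs, ht, rfl⟩ := H
      obtain ⟨q, hq, rfl⟩ := ih t ht
      refine ⟨Fin.cons s q, fun i => ?_, by rw [Fin.prod_univ_succ (Fin.cons s q)]; rfl⟩
      refine Fin.cases ?_ (fun j => ?_) i
      · simpa using hs
      · simpa using hq j
    have root : ∀ p : Polynomial ℂ, 0 < p.natDegree → ∃ (α : ℂ) (t : Polynomial ℂ),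
        t.natDegree + 1 = p.natDegree ∧ p = (Polynomial.X - Polynomial.C α) * t := by
      intro p hp
      obtain ⟨α, hα⟩ := IsAlgClosed.exists_root p (by
        intro h0; rw [Polynomial.natDegree_eq_zero_iff_degree_le_zero.2 h0.le] at hp; omega)
      obtain ⟨t, rfl⟩ := Polynomial.dvd_iff_isRoot.2 hα
      refine ⟨α, t, ?_, rfl⟩
      have ht : t ≠ 0 := by rintro rfl; simp at hp
      rw [Polynomial.natDegree_mul (Polynomial.X_sub_C_ne_zero α) ht, Polynomial.natDegree_X_sub_C,
        add_comm]
    by_cases h2 : p.natDegree ≤ 2 * (n + 1)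
    · exact ⟨1, p, by simp, h2, by simp⟩
    · obtain ⟨α, t, ht, rfl⟩ := root p (by omega)
      obtain ⟨β, t', ht', rfl⟩ := root t (by omega)
      refine ⟨(Polynomial.X - Polynomial.C α) * (Polynomial.X - Polynomial.C β), t', ?_, by omega,
        by ring⟩
      refine Polynomial.natDegree_mul_le.trans ?_
      simp

/-- The restriction of `P` to the curve `s ↦ (s² - 1, i(s² + 1), 2s)` on the isotropic cone. -/
noncomputable def conicPullback : Poly →ₐ[ℂ] Polynomial ℂ :=
  aeval ![Polynomial.X ^ 2 - 1, Polynomial.C Complex.I * (Polynomial.X ^ 2 + 1), 2 * Polynomial.X]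

theorem eval_conicPullback (P : Poly) (s : ℂ) :
    (conicPullback P).eval s = eval ![s ^ 2 - 1, Complex.I * (s ^ 2 + 1), 2 * s] P := by
  have : ((Polynomial.aeval s : Polynomial ℂ →ₐ[ℂ] ℂ).comp conicPullback) =
      aeval ![s ^ 2 - 1, Complex.I * (s ^ 2 + 1), 2 * s] := by
    ext j
    fin_cases j <;> simp [conicPullback]
  have h := DFunLike.congr_fun this P
  simpa [coe_aeval_eq_eval, Polynomial.coe_aeval_eq_eval] using h

theorem natDegree_conicPullback_le {P : Poly} {n : ℕ} (hP : P.IsHomogeneous n) :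
    (conicPullback P).natDegree ≤ 2 * n := by
  have := aeval_natDegree_le P hP.totalDegree_le
    ![Polynomial.X ^ 2 - 1, Polynomial.C Complex.I * (Polynomial.X ^ 2 + 1),
      (2 * Polynomial.X : Polynomial ℂ)] (n := 2) (fun i => by
      fin_cases i
      · simp; compute_degree
      · simp; compute_degree
      · simp)
  rw [mul_comm]
  exact this

theorem exists_conicPullback_eq {q : Polynomial ℂ} (hq : q.natDegree ≤ 2) :
    ∃ L : Poly, L.IsHomogeneous 1 ∧ conicPullback L = q := by
  obtain ⟨a, b, c, rfl⟩ : ∃ a b c : ℂ, q = Polynomial.C a * Polynomial.X ^ 2 +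
      Polynomial.C b * Polynomial.X + Polynomial.C c := by
    refine ⟨q.coeff 2, q.coeff 1, q.coeff 0, ?_⟩
    conv_lhs => rw [Polynomial.as_sum_range_C_mul_X_pow' (p := q) (n := 3) (by omega)]
    simp [Finset.sum_range_succ]
    ring
  refine ⟨C ((a - c) / 2) * X 0 + C (-Complex.I * (a + c) / 2) * X 1 + C (b / 2) * X 2,
    ((isHomogeneous_C_mul_X _ _).add (isHomogeneous_C_mul_X _ _)).add (isHomogeneous_C_mul_X _ _),
    ?_⟩
  refine Polynomial.funext fun s => ?_
  rw [eval_conicPullback]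
  simp
  linear_combination (-(a + c) / 2 * (s ^ 2 + 1)) * Complex.I_sq

theorem eval_smul_of_isHomogeneous {P : Poly} {n : ℕ} (hP : P.IsHomogeneous n) (t : ℂ) (v : C3) :
    eval (t • v) P = t ^ n * eval v P := by
  rw [eval_eq', eval_eq', Finset.mul_sum]
  refine Finset.sum_congr rfl fun d hd => ?_
  have hn : ∑ i, d i = n := by
    rw [hP.degree_eq_sum_deg_support hd]
    exact (Finset.sum_subset (Finset.subset_univ _) fun i _ hi => by simpa using hi).symm
  simp only [Pi.smul_apply, smul_eq_mul, mul_pow, Finset.prod_mul_distrib,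
    Finset.prod_pow_eq_pow_sum, hn]
  ring

theorem exists_linear_prod_sumSq {n : ℕ} {H : Poly} (hH : H.IsHomogeneous (n + 1)) :
    ∃ L : Fin (n + 1) → Poly, (∀ i, (L i).IsHomogeneous 1) ∧ formPoly sumSq ∣ H - ∏ i, L i := by
  obtain ⟨q, hq, hHq⟩ := exists_prod_quadratics n _ (natDegree_conicPullback_le hH)
  choose L hL hLq using fun i => exists_conicPullback_eq (hq i)
  refine ⟨L, hL, ?_⟩
  have hF : (H - ∏ i, L i).IsHomogeneous (n + 1) := by
    refine hH.sub ?_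
    have := IsHomogeneous.prod Finset.univ L (fun _ => 1) fun i _ => hL i
    simpa using this
  have h0 : conicPullback (H - ∏ i, L i) = 0 := by
    rw [map_sub, map_prod, hHq]; simp [hLq]
  set F := H - ∏ i, L i
  have := sumSq_sub_C_dvd 0 (g := X 1) (X_ne_zero _) (P := F) ?_
  · simpa using this
  intro x w hxw hw
  rw [eval_X] at hw
  rw [sumSq_apply, Fin.sum_univ_succ, Fin.sum_univ_two] at hxw
  simp only [Fin.cons_zero, Fin.cons_succ] at hxw
  set t : ℂ := -(x + Complex.I * w 0) / 2 with ht
  have hI := Complex.I_sq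
  have hprod : (x + Complex.I * w 0) * (x - Complex.I * w 0) = -(w 1) ^ 2 := by
    linear_combination hxw - (w 0) ^ 2 * hI
  have ht0 : t ≠ 0 := by
    intro h
    have : x + Complex.I * w 0 = 0 := by linear_combination -2 * h
    rw [this, zero_mul] at hprod
    exact hw (by simpa using hprod.symm)
  have hv : (Fin.cons x w : C3) = t • ![(w 1 / (2 * t)) ^ 2 - 1,
      Complex.I * ((w 1 / (2 * t)) ^ 2 + 1), 2 * (w 1 / (2 * t))] := by
    have key : t * (w 1 / (2 * t)) ^ 2 = (x - Complex.I * w 0) / 2 := by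
      field_simp
      linear_combination hprod - 2 * (x - Complex.I * w 0) * ht
    ext j
    fin_cases j
    · simp
      linear_combination -key - ht
    · change w 0 = t * (Complex.I * ((w 1 / (2 * t)) ^ 2 + 1))
      linear_combination -Complex.I * key - Complex.I * ht + w 0 * hI
    · change w 1 = t * (2 * (w 1 / (2 * t)))
      field_simp
  rw [hv, eval_smul_of_isHomogeneous hF, ← eval_conicPullback, h0]
  simp

theorem pderiv_comm (i j : Fin 3) (P : Poly) : pderiv i (pderiv j P) = pderiv j (pderiv i P) := by
  have h : ⁅(pderiv i : Derivation ℂ Poly Poly), (pderiv j : Derivation ℂ Poly Poly)⁆ = 0 := by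
    refine derivation_ext fun k => ?_
    rw [Derivation.commutator_apply, pderiv_X, pderiv_X, Pi.single_apply, Pi.single_apply]
    split_ifs <;> simp
  have := DFunLike.congr_fun h P
  rw [Derivation.commutator_apply] at this
  exact sub_eq_zero.1 this

theorem isHomogeneous_polarPoly (Q : QuadraticForm ℂ C3) (u : C3) :
    (polarPoly Q u).IsHomogeneous 1 :=
  IsHomogeneous.sum _ _ _ fun i _ => isHomogeneous_C_mul_X _ i

theorem isHomogeneous_dirDeriv (u : C3) {P : Poly} {d : ℕ} (hP : P.IsHomogeneous d) :
    (dirDeriv u P).IsHomogeneous (d - 1) :=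
  IsHomogeneous.sum _ _ _ fun _ _ => hP.pderiv.C_mul _

theorem laplacian_dirDeriv (Q : QuadraticForm ℂ C3) (u : C3) (P : Poly) :
    laplacian Q (dirDeriv u P) = dirDeriv u (laplacian Q P) := by
  have h : ∀ i, laplacian Q (pderiv i P) = pderiv i (laplacian Q P) := fun i => by
    simp only [laplacian_apply, map_sum, pderiv_C_mul]
    refine Finset.sum_congr rfl fun j _ => Finset.sum_congr rfl fun k _ => ?_
    rw [pderiv_comm k i, pderiv_comm j i]
  simp only [dirDeriv, map_sum, ← smul_eq_C_mul, map_smul, h]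

theorem pderiv_polarPoly (Q : QuadraticForm ℂ C3) (u : C3) (j : Fin 3) :
    pderiv j (polarPoly Q u) = C ((Q.toMatrix' *ᵥ u) j) := by
  simp only [polarPoly, map_sum, pderiv_C_mul, pderiv_X, Pi.single_apply]
  simp

/-- The polynomial numerators of the multipoles `∇_{u₁} ⋯ ∇_{uₙ} Q^{-1/2}`. -/
noncomputable def multipole (Q : QuadraticForm ℂ C3) : List C3 → Poly
  | [] => 1
  | u :: us => formPoly Q * dirDeriv u (multipole Q us) -
      ((2 * us.length + 1 : ℕ) : Poly) * (polarPoly Q u * multipole Q us)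

theorem laplacian_natCast_mul (Q : QuadraticForm ℂ C3) (n : ℕ) (P : Poly) :
    laplacian Q ((n : Poly) * P) = (n : Poly) * laplacian Q P := by
  rw [← nsmul_eq_mul, map_nsmul, nsmul_eq_mul]

theorem multipole_mem_Har (hB : IsUnit Q.toMatrix'.det) (us : List C3) :
    multipole Q us ∈ Har Q us.length := by
  induction us with
  | nil => exact ⟨isHomogeneous_one _ _, laplacian_eq_zero_of_lt Q (isHomogeneous_one _ _) two_pos⟩
  | cons u us ih =>
    obtain ⟨hM, hL⟩ := ih
    replace hM : (multipole Q us).IsHomogeneous us.length := hM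
    replace hL : laplacian Q (multipole Q us) = 0 := hL
    have hpolar : laplacian Q (polarPoly Q u * multipole Q us) =
        2 * dirDeriv u (multipole Q us) := by
      rw [laplacian_mul, hL, laplacian_eq_zero_of_lt Q (isHomogeneous_polarPoly Q u) one_lt_two,
        gradPair_linear hB u _ _ (pderiv_polarPoly Q u)]
      ring
    have hdL : laplacian Q (dirDeriv u (multipole Q us)) = 0 := by
      rw [laplacian_dirDeriv, hL]; simp [dirDeriv]
    have hpM := ((isHomogeneous_polarPoly Q u).mul hM)
    have hpM' : (((2 * us.length + 1 : ℕ) : Poly) *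
        (polarPoly Q u * multipole Q us)).IsHomogeneous (us.length + 1) := by
      rw [← map_natCast (C : ℂ →+* Poly), add_comm us.length 1]
      exact hpM.C_mul _
    rcases Nat.eq_zero_or_pos us.length with h0 | hpos
    · have hd0 : dirDeriv u (multipole Q us) = 0 := by
        rw [List.length_eq_zero_iff.1 h0]
        simp [multipole, dirDeriv]
      refine ⟨?_, ?_⟩
      · change (multipole Q (u :: us)).IsHomogeneous _
        rw [multipole, hd0, mul_zero, zero_sub]
        exact hpM'.neg
      · change laplacian Q (multipole Q (u :: us)) = 0
        rw [multipole, hd0, mul_zero, zero_sub, map_neg, laplacian_natCast_mul, hpolar, hd0]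
        simp
    · have hd := isHomogeneous_dirDeriv u hM
      refine ⟨?_, ?_⟩
      · change (multipole Q (u :: us)).IsHomogeneous _
        rw [multipole, List.length_cons]
        refine IsHomogeneous.sub ?_ hpM'
        have := (isHomogeneous_formPoly Q).mul hd
        rwa [show 2 + (us.length - 1) = us.length + 1 by omega] at this
      · change laplacian Q (multipole Q (u :: us)) = 0
        rw [multipole, map_sub, laplacian_natCast_mul, hpolar, laplacian_formPoly_mul hB hd, hdL]
        obtain ⟨m, hm⟩ : ∃ m, us.length = m + 1 := ⟨us.length - 1, by omega⟩
        rw [hm, Nat.add_sub_cancel]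
        push_cast
        ring

/-- The leading coefficient `(-1)ⁿ (2n - 1)!!` of a multipole modulo `Q`. -/
def multipoleCoeff : ℕ → ℂ
  | 0 => 1
  | n + 1 => -((2 * n + 1 : ℕ) : ℂ) * multipoleCoeff n

theorem multipoleCoeff_ne_zero (n : ℕ) : multipoleCoeff n ≠ 0 := by
  induction n with
  | zero => exact one_ne_zero
  | succ n ih => exact mul_ne_zero (neg_ne_zero.2 (Nat.cast_ne_zero.2 (Nat.succ_ne_zero _))) ih

theorem formPoly_dvd_multipole_sub (Q : QuadraticForm ℂ C3) (us : List C3) :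
    formPoly Q ∣ multipole Q us - C (multipoleCoeff us.length) * (us.map (polarPoly Q)).prod := by
  induction us with
  | nil => simp [multipole, multipoleCoeff]
  | cons u us ih =>
    obtain ⟨S, hS⟩ := ih
    refine ⟨dirDeriv u (multipole Q us) -
      ((2 * us.length + 1 : ℕ) : Poly) * polarPoly Q u * S, ?_⟩
    rw [multipole, List.length_cons, multipoleCoeff, List.map_cons, List.prod_cons, C_mul, C_neg,
      map_natCast]
    linear_combination -((2 * us.length + 1 : ℕ) : Poly) * polarPoly Q u * hS

theorem exists_polarPoly_eq (hB : IsUnit Q.toMatrix'.det) {L : Poly} (hL : L.IsHomogeneous 1) :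
    ∃ u : C3, polarPoly Q u = L := by
  have hc : ∀ i, ∃ c : ℂ, pderiv i L = C c := fun i => by
    have h : (pderiv i L).IsHomogeneous 0 := hL.pderiv
    rw [← totalDegree_zero_iff_isHomogeneous, totalDegree_eq_zero_iff_eq_C] at h
    exact ⟨_, h⟩
  choose c hc using hc
  refine ⟨(Q.toMatrix')⁻¹ *ᵥ c, ?_⟩
  rw [polarPoly, Matrix.mulVec_mulVec, Matrix.mul_nonsing_inv _ hB, Matrix.one_mulVec]
  have := hL.sum_X_mul_pderiv
  rw [one_smul] at this
  rw [← this]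
  exact Finset.sum_congr rfl fun i _ => by rw [hc, mul_comm]

theorem exists_linear_prod {A : GL (Fin 3) ℂ} (hA : ReducesToSquares Q A) {n : ℕ} {H : Poly}
    (hH : H.IsHomogeneous (n + 1)) :
    ∃ L : Fin (n + 1) → Poly, (∀ i, (L i).IsHomogeneous 1) ∧ formPoly Q ∣ H - ∏ i, L i := by
  obtain ⟨L, hL, hd⟩ := exists_linear_prod_sumSq (isHomogeneous_substMatrix A⁻¹ hH)
  refine ⟨fun i => substMatrix A (L i), fun i => isHomogeneous_substMatrix A (hL i), ?_⟩
  have := map_dvd (substMatrix A) hd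
  rwa [map_sub, substMatrix_apply_inv, map_prod, substMatrix_formPoly hA.isometry] at this

/-- Every harmonic form of positive degree is a multipole. -/
theorem exists_multipole_eq (hB : IsUnit Q.toMatrix'.det) {A : GL (Fin 3) ℂ}
    (hA : ReducesToSquares Q A) {n : ℕ} {H : Poly} (hH : H ∈ Har Q (n + 1)) :
    ∃ u : Fin (n + 1) → C3, multipole Q (List.ofFn u) = H := by
  have hH' : H.IsHomogeneous (n + 1) := hH.1
  have hκ := multipoleCoeff_ne_zero (n + 1)
  obtain ⟨L, hL, S, hS⟩ := exists_linear_prod hA (hH'.C_mul (multipoleCoeff (n + 1))⁻¹)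
  choose u hu using fun i => exists_polarPoly_eq hB (hL i)
  refine ⟨u, ?_⟩
  obtain ⟨T, hT⟩ := formPoly_dvd_multipole_sub Q (List.ofFn u)
  have hM := multipole_mem_Har hB (List.ofFn u)
  rw [List.length_ofFn] at hT hM
  rw [List.map_ofFn, List.prod_ofFn] at hT
  have hprod : ∏ i, (polarPoly Q ∘ u) i = ∏ i, L i := Finset.prod_congr rfl fun i _ => hu i
  rw [hprod] at hT
  have hc : C (multipoleCoeff (n + 1)) * (C (multipoleCoeff (n + 1))⁻¹ * H) = H := by
    rw [← mul_assoc, ← C_mul, mul_inv_cancel₀ hκ, C_1, one_mul]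
  refine sub_eq_zero.1 (eq_zero_of_mem_Har_of_formPoly_dvd hB (sub_mem hM hH)
    ⟨T - C (multipoleCoeff (n + 1)) * S, ?_⟩)
  linear_combination hT - C (multipoleCoeff (n + 1)) * hS + hc

theorem hasDerivAt_eval_add_smul (P : Poly) (v u : C3) (t : ℂ) :
    HasDerivAt (fun t : ℂ => eval (v + t • u) P) (eval (v + t • u) (dirDeriv u P)) t := by
  have hd : ∀ P : Poly, eval (v + t • u) (dirDeriv u P) =
      ∑ i, u i * eval (v + t • u) (pderiv i P) := fun P => by simp [dirDeriv]
  rw [hd]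
  induction P using MvPolynomial.induction_on with
  | C a => simpa using hasDerivAt_const t a
  | add p q hp hq =>
    simp only [map_add, mul_add, Finset.sum_add_distrib]
    exact hp.add hq
  | mul_X p k hp =>
    simp only [map_mul, eval_X]
    have hk : HasDerivAt (fun t : ℂ => (v + t • u) k) (u k) t := by
      simpa using ((hasDerivAt_id t).mul_const (u k)).const_add (v k)
    refine (hp.mul hk).congr_deriv ?_
    simp only [pderiv_mul, pderiv_X, map_add, map_mul, eval_X, mul_add, Finset.sum_add_distrib,
      Finset.sum_mul, mul_assoc]
    congr 1
    rw [Finset.sum_eq_single k]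
    · simp [mul_comm]
    · intro b _ hb; simp [hb.symm]
    · simp

theorem eval_dirDeriv_formPoly (Q : QuadraticForm ℂ C3) (u v : C3) :
    eval v (dirDeriv u (formPoly Q)) = 2 * eval v (polarPoly Q u) := by
  have hs := (QuadraticForm.isSymm_toMatrix' Q).apply
  simp only [dirDeriv, pderiv_formPoly, polarPoly, Fin.sum_univ_three, Matrix.mulVec, dotProduct,
    map_add, map_mul, eval_C, eval_X, map_ofNat, hs 0 1, hs 0 2, hs 1 2]
  ring

theorem IsSqrtBranch.ne {Ω : Set C3} {r : C3 → ℂ} (h : IsSqrtBranch Q Ω r) {v : C3} (hv : v ∈ Ω) :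
    r v ≠ 0 := by
  intro h0
  have := h.sq_eq v hv
  rw [h0] at this
  exact h.ne_zero v hv (by rw [← this]; simp)

theorem iterDirDeriv_inv_sqrt {Ω : Set C3} {r : C3 → ℂ} (h : IsSqrtBranch Q Ω r)
    (us : List C3) : ∀ v ∈ Ω, iterDirDeriv us (fun w => (r w)⁻¹) v =
      eval v (multipole Q us) * (r v ^ (2 * us.length + 1))⁻¹ := by
  induction us with
  | nil => intro v _; simp [iterDirDeriv, multipole]
  | cons u us ih =>
    intro v hv
    have hnear : ∀ᶠ t : ℂ in nhds 0, v + t • u ∈ Ω := by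
      have hc : ContinuousAt (fun t : ℂ => v + t • u) 0 := by fun_prop
      exact hc.eventually_mem (h.isOpen.mem_nhds (by simpa using hv))
    have hr : HasDerivAt (fun t : ℂ => r (v + t • u)) (eval v (polarPoly Q u) / r v) 0 := by
      have hdiff : DifferentiableAt ℂ (fun t : ℂ => r (v + t • u)) 0 := by
        have h1 : DifferentiableAt ℂ r (v + (0 : ℂ) • u) :=
          h.holomorphic.differentiableAt (h.isOpen.mem_nhds (by simpa using hv))
        exact DifferentiableAt.comp (0 : ℂ) h1 (by fun_prop)
      have h1 := hdiff.hasDerivAt.fun_pow 2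
      have h2 := hasDerivAt_eval_add_smul (formPoly Q) v u 0
      have h3 : (fun t : ℂ => r (v + t • u) ^ 2) =ᶠ[nhds 0]
          fun t => eval (v + t • u) (formPoly Q) := by
        filter_upwards [hnear] with t ht
        rw [h.sq_eq _ ht, eval_formPoly]
      have h4 := h1.unique (h2.congr_of_eventuallyEq h3)
      simp only [zero_smul, add_zero, eval_dirDeriv_formPoly] at h4
      refine hdiff.hasDerivAt.congr_deriv ?_
      have := h.ne hv
      field_simp
      norm_num at h4
      linear_combination h4 / 2
    have hM := hasDerivAt_eval_add_smul (multipole Q us) v u 0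
    have hr0 := h.ne hv
    have hg := hM.mul ((hr.fun_pow (2 * us.length + 1)).inv (by
      simpa only [zero_smul, add_zero] using pow_ne_zero _ hr0))
    change deriv (fun t : ℂ => iterDirDeriv us (fun w => (r w)⁻¹) (v + t • u)) 0 = _
    have heq : (fun t : ℂ => iterDirDeriv us (fun w => (r w)⁻¹) (v + t • u)) =ᶠ[nhds 0]
        fun t => eval (v + t • u) (multipole Q us) * (r (v + t • u) ^ (2 * us.length + 1))⁻¹ := by
      filter_upwards [hnear] with t ht using ih _ ht
    rw [heq.deriv_eq]
    refine hg.deriv.trans ?_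
    simp only [zero_smul, add_zero, multipole, map_sub, map_mul, eval_formPoly, map_natCast,
      List.length_cons, ← h.sq_eq v hv, Nat.add_sub_cancel, Pi.inv_apply]
    rw [show 2 * (us.length + 1) + 1 = 2 * us.length + 1 + 2 by ring]
    have hp : r v ^ (2 * us.length) ≠ 0 := pow_ne_zero _ hr0
    simp only [pow_add, pow_one]
    field_simp
    ring

theorem exists_maxwell (hB : IsUnit Q.toMatrix'.det) {A : GL (Fin 3) ℂ}
    (hA : ReducesToSquares Q A) {d : ℕ} {P : Poly} (hP : P ∈ V d) :
    ∃ (a : ℂ) (u : (k : ℕ) → Fin (d - 2 * k) → C3),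
      ∀ (Ω : Set C3) (r : C3 → ℂ), IsSqrtBranch Q Ω r →
        ∀ v ∈ Ω, eval v P = ∑ k ∈ Finset.range (d / 2 + 1),
          (if 2 * k = d then a else 1) * r v ^ (2 * (d - k) + 1) *
            iterDirDeriv (List.ofFn (u k)) (fun w => (r w)⁻¹) v := by
  obtain ⟨h, hh, rfl⟩ := exists_harmonic_expansion hB d P hP
  have hu : ∀ k, ∃ u : Fin (d - 2 * k) → C3, 2 * k < d → multipole Q (List.ofFn u) = h k := by
    intro k
    have hk := hh k
    generalize hn : d - 2 * k = n at hk
    cases n with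
    | zero => exact ⟨fun _ => 0, fun hlt => by omega⟩
    | succ n =>
      obtain ⟨u, hu⟩ := exists_multipole_eq hB hA hk
      exact ⟨u, fun _ => hu⟩
  choose u hu using hu
  refine ⟨coeff 0 (h (d / 2)), u, fun Ω r hr v hv => ?_⟩
  rw [map_sum]
  refine Finset.sum_congr rfl fun k hk => ?_
  rw [Finset.mem_range] at hk
  have hr0 := hr.ne hv
  rw [iterDirDeriv_inv_sqrt hr _ v hv, map_mul, map_pow, eval_formPoly, ← hr.sq_eq v hv,
    List.length_ofFn, show 2 * (d - k) + 1 = 2 * k + (2 * (d - 2 * k) + 1) by omega, pow_add,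
    ← pow_mul]
  have hp : r v ^ (2 * (d - 2 * k) + 1) ≠ 0 := pow_ne_zero _ hr0
  by_cases hkd : 2 * k = d
  · have hM : multipole Q (List.ofFn (u k)) = 1 := by
      have : (List.ofFn (u k)) = [] := List.length_eq_zero_iff.1 (by rw [List.length_ofFn]; omega)
      rw [this, multipole]
    have hk0 : h k = C (coeff 0 (h k)) := by
      have h0 : (h k).IsHomogeneous (d - 2 * k) := (hh k).1
      rw [show d - 2 * k = 0 by omega, ← totalDegree_zero_iff_isHomogeneous,
        totalDegree_eq_zero_iff_eq_C] at h0
      exact h0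
    rw [if_pos hkd, hM, show d / 2 = k by omega, hk0]
    simp only [eval_C, coeff_C, if_true, map_one]
    field_simp
  · rw [if_neg hkd, hu k (by omega)]
    field_simp

/-- The inclusion `ℝ³ → ℂ³`. -/
def toC (x : EuclideanSpace ℝ (Fin 3)) : C3 := fun i => ((x i : ℝ) : ℂ)

theorem continuous_toC : Continuous toC := by
  unfold toC
  fun_prop

theorem continuous_eval_toC (P : Poly) : Continuous fun x => eval (toC x) P :=
  (MvPolynomial.continuous_eval P).comp continuous_toC

theorem toC_add_smul (x y : EuclideanSpace ℝ (Fin 3)) (t : ℝ) :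
    toC (x + t • y) = toC x + (t : ℂ) • toC y := by
  ext i; simp [toC]

theorem toC_smul (x : EuclideanSpace ℝ (Fin 3)) (t : ℝ) : toC (t • x) = (t : ℂ) • toC x := by
  ext i; simp [toC]

theorem eq_zero_of_eval_toC {P : Poly} (h : ∀ x ≠ 0, eval (toC x) P = 0) : P = 0 := by
  refine MvPolynomial.funext_set (fun _ => ((↑) : ℝ → ℂ) '' Set.Ioi 0)
    (fun _ => (Set.Ioi_infinite 0).image Complex.ofReal_injective.injOn) fun v hv => ?_
  choose y hy0 hy using fun i => hv i (Set.mem_univ i)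
  have : v = toC (WithLp.toLp 2 y) := by ext i; simp [toC, hy]
  rw [this, map_zero]
  refine h _ fun h0 => (Set.mem_Ioi.1 (hy0 0)).ne' ?_
  simpa using congrArg (fun x : EuclideanSpace ℝ (Fin 3) => x 0) h0

/-- The Gaussian weight, as a function of the radius. -/
noncomputable def gauss (r : ℝ) : ℝ := Real.exp (-(1 / 2) * r ^ 2)

theorem continuous_gauss : Continuous gauss := by unfold gauss; fun_prop

theorem gauss_pos (r : ℝ) : 0 < gauss r := Real.exp_pos _

theorem integrableOn_pow_mul_gauss (n : ℕ) :
    IntegrableOn (fun r : ℝ => r ^ n * gauss r) (Set.Ioi 0) := by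
  have := integrable_rpow_mul_exp_neg_mul_sq (b := 1 / 2) (by norm_num) (s := n)
    (by have : (0 : ℝ) ≤ n := n.cast_nonneg
        linarith)
  refine (this.integrableOn (s := Set.Ioi 0)).congr_fun (fun r _ => ?_) measurableSet_Ioi
  simp [gauss, Real.rpow_natCast]

theorem integrable_norm_pow_mul_gauss (n : ℕ) :
    Integrable fun x : EuclideanSpace ℝ (Fin 3) => ‖x‖ ^ n * gauss ‖x‖ := by
  rw [integrable_fun_norm_addHaar volume (f := fun r => r ^ n * gauss r)]
  refine (integrableOn_pow_mul_gauss (2 + n)).congr_fun (fun r _ => ?_) measurableSet_Ioi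
  simp [finrank_euclideanSpace, pow_add, mul_assoc]

theorem integrable_eval_mul_gauss (P : Poly) :
    Integrable fun x : EuclideanSpace ℝ (Fin 3) => eval (toC x) P * (gauss ‖x‖ : ℂ) := by
  have hsum : (fun x : EuclideanSpace ℝ (Fin 3) => eval (toC x) P * (gauss ‖x‖ : ℂ)) = fun x =>
      ∑ d ∈ P.support, coeff d P * (∏ i, toC x i ^ d i) * (gauss ‖x‖ : ℂ) := by
    funext x
    rw [eval_eq', Finset.sum_mul]
  rw [hsum]
  refine integrable_finsetSum _ fun d _ => ?_
  refine ((integrable_norm_pow_mul_gauss (∑ i, d i)).const_mul ‖coeff d P‖).mono' ?_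
    (.of_forall fun x => ?_)
  · refine Continuous.aestronglyMeasurable ?_
    refine (continuous_const.mul (continuous_finsetProd _ fun i _ => ?_)).mul
      (Complex.continuous_ofReal.comp (continuous_gauss.comp continuous_norm))
    exact ((continuous_apply i).comp continuous_toC).pow _
  · rw [norm_mul, norm_mul, Complex.norm_real, Real.norm_of_nonneg (gauss_pos _).le, mul_assoc]
    have hx : ∏ i, ‖toC x i ^ d i‖ ≤ ‖x‖ ^ ∑ i, d i := by
      rw [← Finset.prod_pow_eq_pow_sum]
      refine Finset.prod_le_prod (fun i _ => norm_nonneg _) fun i _ => ?_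
      rw [norm_pow, toC, Complex.norm_real]
      exact pow_le_pow_left₀ (norm_nonneg _) (PiLp.norm_apply_le x i) _
    rw [norm_prod]
    exact mul_le_mul_of_nonneg_left (mul_le_mul_of_nonneg_right hx (gauss_pos _).le)
      (norm_nonneg _)

/-- The Gaussian integral of a polynomial over `ℝ³`. -/
noncomputable def gaussInt : Poly →ₗ[ℂ] ℂ where
  toFun P := ∫ x : EuclideanSpace ℝ (Fin 3), eval (toC x) P * (gauss ‖x‖ : ℂ)
  map_add' P R := by
    rw [← integral_add (integrable_eval_mul_gauss P) (integrable_eval_mul_gauss R)]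
    simp [add_mul]
  map_smul' c P := by
    simp [smul_eval, mul_assoc, integral_const_mul]

theorem gaussInt_pderiv (i : Fin 3) (P : Poly) :
    gaussInt (pderiv i P) = gaussInt (X i * P) := by
  have hP : ∀ x : EuclideanSpace ℝ (Fin 3), HasLineDerivAt ℝ (fun x => eval (toC x) P)
      (eval (toC x) (pderiv i P)) x (EuclideanSpace.single i 1) := by
    intro x
    have h := (hasDerivAt_eval_add_smul P (toC x) (Pi.single i 1) ((0 : ℝ) : ℂ)).comp_ofReal
    have hd : dirDeriv (Pi.single i 1) P = pderiv i P := by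
      rw [dirDeriv, Finset.sum_eq_single i] <;> simp +contextual
    have hs : toC (EuclideanSpace.single i 1) = Pi.single i 1 := by
      ext j; simp only [toC, PiLp.single_apply, Pi.single_apply]; split_ifs <;> simp
    rw [hd] at h
    rw [HasLineDerivAt]
    simp only [toC_add_smul, hs]
    simpa using h
  have hg : ∀ x : EuclideanSpace ℝ (Fin 3), HasLineDerivAt ℝ (fun x => (gauss ‖x‖ : ℂ))
      (-(x i : ℂ) * (gauss ‖x‖ : ℂ)) x (EuclideanSpace.single i 1) := by
    intro x
    rw [HasLineDerivAt]
    have h1 : ∀ t : ℝ, gauss ‖x + t • EuclideanSpace.single i (1 : ℝ)‖ =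
        Real.exp (-(1 / 2) * (‖x‖ ^ 2 + 2 * (t * x i) + t ^ 2)) := by
      intro t
      rw [gauss, norm_add_sq_real, inner_smul_right, norm_smul, EuclideanSpace.inner_single_right]
      simp
    have h2 : HasDerivAt (fun t : ℝ => Real.exp (-(1 / 2) * (‖x‖ ^ 2 + 2 * (t * x i) + t ^ 2)))
        (-(x i) * gauss ‖x‖) 0 := by
      have h3 : HasDerivAt (fun t : ℝ => -(1 / 2) * (‖x‖ ^ 2 + 2 * (t * x i) + t ^ 2))
          (-(x i)) 0 := by
        have h4 := (((((hasDerivAt_id (0 : ℝ)).mul_const (x i)).const_mul 2).const_add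
          (‖x‖ ^ 2)).add ((hasDerivAt_id (0 : ℝ)).pow 2)).const_mul (-(1 / 2))
        simpa using h4
      have h5 := h3.exp
      refine h5.congr_deriv ?_
      simp [gauss]; ring
    simp only [h1]
    simpa using h2.ofReal_comp
  have h := integral_bilinear_hasLineDerivAt_right_eq_neg_left_of_integrable
    (μ := (volume : Measure (EuclideanSpace ℝ (Fin 3)))) (B := ContinuousLinearMap.mul ℝ ℂ)
    (f := fun x => eval (toC x) P) (f' := fun x => eval (toC x) (pderiv i P))
    (g := fun x => (gauss ‖x‖ : ℂ)) (g' := fun x => -(x i : ℂ) * (gauss ‖x‖ : ℂ))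
    (v := EuclideanSpace.single i 1) (integrable_eval_mul_gauss _) ?_ (integrable_eval_mul_gauss _)
    (fun x _ => hP x) (fun x _ => hg x)
  · simp only [ContinuousLinearMap.mul_apply'] at h
    rw [eq_neg_iff_add_eq_zero, add_comm, ← eq_neg_iff_add_eq_zero, ← integral_neg] at h
    change ∫ x, _ = ∫ x, _
    rw [h]
    refine integral_congr_ae (.of_forall fun x => ?_)
    simp [toC]; ring
  · refine (integrable_eval_mul_gauss (-(X i * P))).congr (.of_forall fun x => ?_)
    simp [toC]; ring

theorem laplacian_sumSq (P : Poly) : laplacian sumSq P = ∑ i, pderiv i (pderiv i P) := by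
  rw [laplacian_apply, toMatrix'_sumSq]
  simp [Matrix.one_apply]

/-- Harmonic forms of different degrees are orthogonal for the Gaussian weight. -/
theorem gaussInt_mul_eq_zero {m n : ℕ} (hmn : m ≠ n) {P T : Poly} (hP : P ∈ Har sumSq m)
    (hT : T ∈ Har sumSq n) : gaussInt (P * T) = 0 := by
  have hPm : P.IsHomogeneous m := hP.1
  have hTn : T.IsHomogeneous n := hT.1
  have hPΔ : laplacian sumSq P = 0 := hP.2
  have hTΔ : laplacian sumSq T = 0 := hT.2
  rw [laplacian_sumSq] at hPΔ hTΔ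
  have h1 : ∑ i, pderiv i (T * pderiv i P - P * pderiv i T) = 0 := by
    have : ∀ i, pderiv i (T * pderiv i P - P * pderiv i T) =
        T * pderiv i (pderiv i P) - P * pderiv i (pderiv i T) := fun i => by
      rw [map_sub, pderiv_mul, pderiv_mul]; ring
    simp only [this, Finset.sum_sub_distrib, ← Finset.mul_sum, hPΔ, hTΔ, mul_zero, sub_zero]
  have h2 : ∑ i, X i * (T * pderiv i P - P * pderiv i T) = ((m : ℂ) - n) • (P * T) := by
    have : ∀ i, X i * (T * pderiv i P - P * pderiv i T) =
        T * (X i * pderiv i P) - P * (X i * pderiv i T) := fun i => by ring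
    simp only [this, Finset.sum_sub_distrib, ← Finset.mul_sum, hPm.sum_X_mul_pderiv,
      hTn.sum_X_mul_pderiv]
    rw [smul_eq_C_mul, C_sub, map_natCast, map_natCast, nsmul_eq_mul, nsmul_eq_mul]
    ring
  have h3 : ((m : ℂ) - n) * gaussInt (P * T) = 0 := by
    rw [← smul_eq_mul, ← map_smul, ← h2, map_sum]
    simp only [← gaussInt_pderiv]
    rw [← map_sum, h1, map_zero]
  refine (mul_eq_zero.1 h3).resolve_left ?_
  exact sub_ne_zero.2 (Nat.cast_injective.ne hmn)

theorem continuous_eval_sphere (P : Poly) :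
    Continuous fun x : Metric.sphere (0 : EuclideanSpace ℝ (Fin 3)) 1 => eval (toC x) P :=
  (continuous_eval_toC P).comp continuous_subtype_val

theorem integrable_eval_sphere (P : Poly) :
    Integrable (fun x : Metric.sphere (0 : EuclideanSpace ℝ (Fin 3)) 1 => eval (toC x) P)
      (volume : Measure (EuclideanSpace ℝ (Fin 3))).toSphere :=
  (continuous_eval_sphere P).integrable_of_hasCompactSupport (HasCompactSupport.of_compactSpace _)

/-- The integral of a polynomial over the unit sphere of `ℝ³`. -/
noncomputable def sphereInt : Poly →ₗ[ℂ] ℂ where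
  toFun P := ∫ x, eval (toC x) P ∂(volume : Measure (EuclideanSpace ℝ (Fin 3))).toSphere
  map_add' P R := by
    rw [← integral_add (integrable_eval_sphere P) (integrable_eval_sphere R)]
    simp
  map_smul' c P := by
    simp [smul_eval, integral_const_mul]

theorem gaussInt_eq {m : ℕ} {P : Poly} (hP : P.IsHomogeneous m) :
    gaussInt P = sphereInt P * (∫ r in Set.Ioi (0 : ℝ), r ^ (2 + m) * gauss r : ℝ) := by
  set μ : Measure (EuclideanSpace ℝ (Fin 3)) := volume
  set g : Metric.sphere (0 : EuclideanSpace ℝ (Fin 3)) 1 × Set.Ioi (0 : ℝ) → ℂ :=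
    fun p => eval (toC p.1) P * ((p.2.1 ^ m * gauss p.2 : ℝ) : ℂ) with hg
  have hpolar : ∀ x : ({0}ᶜ : Set (EuclideanSpace ℝ (Fin 3))),
      eval (toC x) P * (gauss ‖x.1‖ : ℂ) = g (homeomorphUnitSphereProd _ x) := by
    intro x
    have hx : (‖x.1‖ : ℂ) ≠ 0 := by
      rw [Complex.ofReal_ne_zero, norm_ne_zero_iff]; exact x.2
    simp only [hg, homeomorphUnitSphereProd_apply_fst_coe, homeomorphUnitSphereProd_apply_snd_coe,
      toC_smul, eval_smul_of_isHomogeneous hP]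
    push_cast
    rw [inv_pow]
    field_simp
  calc gaussInt P = ∫ x : ({0}ᶜ : Set (EuclideanSpace ℝ (Fin 3))),
        eval (toC x) P * (gauss ‖x.1‖ : ℂ) ∂(μ.comap (↑)) := by
        rw [integral_subtype_comap (measurableSet_singleton _).compl
          fun x => eval (toC x) P * (gauss ‖x‖ : ℂ), restrict_compl_singleton]
        rfl
    _ = ∫ p, g p ∂(μ.toSphere.prod (.volumeIoiPow 2)) := by
        simp only [hpolar]
        have := μ.measurePreserving_homeomorphUnitSphereProd.integral_comp
          (Homeomorph.measurableEmbedding _) g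
        rw [finrank_euclideanSpace, Fintype.card_fin] at this
        exact this
    _ = sphereInt P * ∫ r : Set.Ioi (0 : ℝ), ((r.1 ^ m * gauss r : ℝ) : ℂ) ∂.volumeIoiPow 2 :=
        integral_prod_mul (fun x : Metric.sphere (0 : EuclideanSpace ℝ (Fin 3)) 1 =>
          eval (toC x) P) fun r : Set.Ioi (0 : ℝ) => ((r.1 ^ m * gauss r : ℝ) : ℂ)
    _ = _ := by
        rw [integral_complex_ofReal]
        congr 2
        simp only [Measure.volumeIoiPow, ENNReal.ofReal]
        rw [integral_withDensity_eq_integral_smul,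
          integral_subtype_comap measurableSet_Ioi
            fun a : ℝ => Real.toNNReal (a ^ 2) • (a ^ m * gauss a),
          setIntegral_congr_fun measurableSet_Ioi fun x hx => ?_]
        · rw [NNReal.smul_def, Real.coe_toNNReal _ (sq_nonneg _), smul_eq_mul, pow_add, mul_assoc]
        · exact (measurable_subtype_coe.pow_const _).real_toNNReal

theorem sphereInt_mul_eq_zero {m n : ℕ} (hmn : m ≠ n) {P T : Poly} (hP : P ∈ Har sumSq m)
    (hT : T ∈ Har sumSq n) : sphereInt (P * T) = 0 := by
  have h := gaussInt_mul_eq_zero hmn hP hT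
  rw [gaussInt_eq (IsHomogeneous.mul (show P.IsHomogeneous m from hP.1) hT.1)] at h
  refine (mul_eq_zero.1 h).resolve_right (Complex.ofReal_ne_zero.2 (ne_of_gt ?_))
  have hpos : ∀ r ∈ Set.Ioi (0 : ℝ), 0 < r ^ (2 + (m + n)) * gauss r := fun r hr =>
    mul_pos (pow_pos hr _) (gauss_pos r)
  rw [setIntegral_pos_iff_support_of_nonneg_ae
    ((ae_restrict_mem measurableSet_Ioi).mono fun r hr => (hpos r hr).le)
    (integrableOn_pow_mul_gauss _)]
  have : Set.Ioi (0 : ℝ) ⊆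
      Function.support (fun r : ℝ => r ^ (2 + (m + n)) * gauss r) ∩ Set.Ioi 0 :=
    fun r hr => ⟨(hpos r hr).ne', hr⟩
  exact lt_of_lt_of_le (by simp) (measure_mono this)

/-- Complex conjugation of the coefficients. -/
noncomputable def conjPoly : Poly →+* Poly := MvPolynomial.map (starRingEnd ℂ)

theorem eval_conjPoly (P : Poly) (x : EuclideanSpace ℝ (Fin 3)) :
    eval (toC x) (conjPoly P) = conj (eval (toC x) P) := by
  induction P using MvPolynomial.induction_on with
  | C a => simp [conjPoly]
  | add p q hp hq => simp only [map_add, hp, hq]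
  | mul_X p k hp =>
    rw [map_mul, map_mul, hp, map_mul, map_mul]
    simp [conjPoly, toC]

theorem conjPoly_mem_Har {P : Poly} {d : ℕ} (hP : P ∈ Har sumSq d) :
    conjPoly P ∈ Har sumSq d := by
  have hPΔ : laplacian sumSq P = 0 := hP.2
  refine ⟨IsHomogeneous.map hP.1 _, ?_⟩
  change laplacian sumSq _ = 0
  rw [laplacian_sumSq] at hPΔ ⊢
  have := congrArg conjPoly hPΔ
  simp only [conjPoly, map_sum, map_zero, ← pderiv_map] at this
  exact this

theorem isClosed_ellipsoid (Q : QuadraticForm ℂ C3) (A : GL (Fin 3) ℂ) :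
    IsClosed (ellipsoid Q A) := by
  have h1 : Continuous fun v : C3 => Q v := by
    simp only [← eval_formPoly]
    exact MvPolynomial.continuous_eval _
  have h2 : ∀ i, Continuous fun v : C3 => ((v ᵥ* A.val) i).im := fun i => by
    refine Complex.continuous_im.comp ?_
    simp only [Matrix.vecMul, dotProduct]
    fun_prop
  have : ellipsoid Q A = {v | Q v = 1} ∩ ⋂ i, {v | ((v ᵥ* A.val) i).im = 0} := by
    ext v; simp [ellipsoid, surface]
  rw [this]
  exact (isClosed_eq h1 continuous_const).inter
    (isClosed_iInter fun i => isClosed_eq (h2 i) continuous_const)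

theorem ReducesToSquares.mem_ellipsoid {A : GL (Fin 3) ℂ} (hA : ReducesToSquares Q A)
    (x : Metric.sphere (0 : EuclideanSpace ℝ (Fin 3)) 1) :
    toC x ᵥ* (A⁻¹).val ∈ ellipsoid Q A := by
  refine ⟨?_, fun i => ?_⟩
  · have hx : ‖x.1‖ = 1 := by simp
    have hx2 : ∑ i, (x.1 i) ^ 2 = 1 := by
      rw [← EuclideanSpace.real_norm_sq_eq, hx, one_pow]
    change Q _ = 1
    rw [hA.isometry_inv, sumSq_apply]
    simp only [toC]
    exact_mod_cast hx2
  · rw [Matrix.vecMul_vecMul, ← Units.val_mul, inv_mul_cancel, Units.val_one, Matrix.vecMul_one]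
    simp [toC]

theorem herm_eq_sphereInt {A : GL (Fin 3) ℂ} (hA : ReducesToSquares Q A) (P T : Poly) :
    herm Q A P T = sphereInt (substMatrix A⁻¹ P * conjPoly (substMatrix A⁻¹ T)) := by
  have hcont : Continuous fun x : Metric.sphere (0 : EuclideanSpace ℝ (Fin 3)) 1 =>
      toC x ᵥ* (A⁻¹).val := by
    have : Continuous fun x : Metric.sphere (0 : EuclideanSpace ℝ (Fin 3)) 1 => toC x :=
      continuous_toC.comp continuous_subtype_val
    exact this.matrix_vecMul continuous_const
  have hF : Continuous fun v : C3 => eval v P * conj (eval v T) :=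
    (MvPolynomial.continuous_eval P).mul
      (Complex.continuous_conj.comp (MvPolynomial.continuous_eval T))
  have hm : ellipsoidMeasure A = Measure.map (fun x => toC x.1 ᵥ* (A⁻¹).val)
    (volume : Measure (EuclideanSpace ℝ (Fin 3))).toSphere := rfl
  rw [herm, hm, setIntegral_map (isClosed_ellipsoid Q A).measurableSet hF.aestronglyMeasurable
    hcont.measurable.aemeasurable,
    show (fun x : Metric.sphere (0 : EuclideanSpace ℝ (Fin 3)) 1 => toC x.1 ᵥ* (A⁻¹).val) ⁻¹'
      ellipsoid Q A = Set.univ from Set.eq_univ_of_forall hA.mem_ellipsoid, Measure.restrict_univ]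
  refine integral_congr_ae (.of_forall fun x => ?_)
  simp only [map_mul, eval_conjPoly, eval_substMatrix]

theorem herm_formPoly_pow_mul (Q : QuadraticForm ℂ C3) (A : GL (Fin 3) ℂ) (k l : ℕ) (P T : Poly) :
    herm Q A (formPoly Q ^ k * P) (formPoly Q ^ l * T) = herm Q A P T := by
  refine setIntegral_congr_fun (isClosed_ellipsoid Q A).measurableSet fun v hv => ?_
  have hv' : Q v = 1 := hv.1
  simp [eval_formPoly, hv']

theorem herm_eq_zero_of_mem_Har {A : GL (Fin 3) ℂ} (hA : ReducesToSquares Q A) {m n : ℕ}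
    (hmn : m ≠ n) {P T : Poly} (hP : P ∈ Har Q m) (hT : T ∈ Har Q n) : herm Q A P T = 0 := by
  rw [herm_eq_sphereInt hA]
  exact sphereInt_mul_eq_zero hmn (mem_Har_substMatrix hA.isometry_inv hP)
    (conjPoly_mem_Har (mem_Har_substMatrix hA.isometry_inv hT))

theorem herm_add_left {A : GL (Fin 3) ℂ} (hA : ReducesToSquares Q A) (P R T : Poly) :
    herm Q A (P + R) T = herm Q A P T + herm Q A R T := by
  simp only [herm_eq_sphereInt hA, map_add, add_mul]

theorem herm_conj_symm {A : GL (Fin 3) ℂ} (P T : Poly) :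
    conj (herm Q A P T) = herm Q A T P := by
  rw [herm, herm, ← integral_conj]
  simp [mul_comm]

theorem herm_add_right {A : GL (Fin 3) ℂ} (hA : ReducesToSquares Q A) (P R T : Poly) :
    herm Q A P (R + T) = herm Q A P R + herm Q A P T := by
  simp only [herm_eq_sphereInt hA, map_add, mul_add]

theorem herm_sum_right {A : GL (Fin 3) ℂ} (hA : ReducesToSquares Q A) {ι : Type*} (s : Finset ι)
    (P : Poly) (T : ι → Poly) : herm Q A P (∑ i ∈ s, T i) = ∑ i ∈ s, herm Q A P (T i) := by
  simp only [herm_eq_sphereInt hA, map_sum, Finset.mul_sum]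

theorem herm_smul_right (A : GL (Fin 3) ℂ) (c : ℂ) (P T : Poly) :
    herm Q A P (c • T) = conj c * herm Q A P T := by
  rw [herm, herm, ← integral_const_mul]
  simp only [smul_eval, map_mul]
  exact integral_congr_ae (.of_forall fun v => by ring)

theorem herm_self {A : GL (Fin 3) ℂ} (hA : ReducesToSquares Q A) (P : Poly) :
    herm Q A P P = (∫ x, Complex.normSq (eval (toC x) (substMatrix A⁻¹ P))
      ∂(volume : Measure (EuclideanSpace ℝ (Fin 3))).toSphere : ℝ) := by
  rw [herm_eq_sphereInt hA, ← integral_complex_ofReal]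
  refine integral_congr_ae (.of_forall fun x => ?_)
  simp only [map_mul, eval_conjPoly, Complex.mul_conj]

theorem eq_zero_of_herm_self {A : GL (Fin 3) ℂ} (hA : ReducesToSquares Q A) {d : ℕ} {P : Poly}
    (hP : P.IsHomogeneous d) (h : herm Q A P P = 0) : P = 0 := by
  rw [herm_self hA, Complex.ofReal_eq_zero] at h
  have hcont : Continuous fun x : Metric.sphere (0 : EuclideanSpace ℝ (Fin 3)) 1 =>
      Complex.normSq (eval (toC x) (substMatrix A⁻¹ P)) :=
    Complex.continuous_normSq.comp (continuous_eval_sphere _)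
  rw [integral_eq_zero_iff_of_nonneg (fun x => Complex.normSq_nonneg _)
    (hcont.integrable_of_hasCompactSupport (HasCompactSupport.of_compactSpace _)),
    Continuous.ae_eq_iff_eq _ hcont continuous_zero] at h
  have hp : substMatrix A⁻¹ P = 0 := by
    refine eq_zero_of_eval_toC fun x hx => ?_
    have hom := isHomogeneous_substMatrix A⁻¹ hP
    have hx' : ‖x‖ ≠ 0 := norm_ne_zero_iff.2 hx
    have hs : ‖x‖⁻¹ • x ∈ Metric.sphere (0 : EuclideanSpace ℝ (Fin 3)) 1 := by
      simp [norm_smul, hx']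
    have h0 := congrFun h ⟨_, hs⟩
    simp only [Pi.zero_apply, Complex.normSq_eq_zero] at h0
    have : x = ‖x‖ • (‖x‖⁻¹ • x) := by rw [smul_smul, mul_inv_cancel₀ hx', one_smul]
    rw [this, toC_smul, eval_smul_of_isHomogeneous hom, h0, mul_zero]
  rw [← substMatrix_apply_inv A P, hp, map_zero]

theorem exists_innerProductCore {A : GL (Fin 3) ℂ} (hA : ReducesToSquares Q A) (d : ℕ) :
    ∃ ip : InnerProductSpace.Core ℂ (V d), ∀ P T : V d, ip.inner T P = herm Q A P T :=
  ⟨{ inner := fun T P => herm Q A P T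
     conj_inner_symm := fun P T => herm_conj_symm _ _
     re_inner_nonneg := fun P => by
      rw [herm_self hA]
      exact integral_nonneg fun x => Complex.normSq_nonneg _
     add_left := fun P R T => herm_add_right hA _ _ _
     smul_left := fun P T c => herm_smul_right A c _ _
     definite := fun P hP => Subtype.ext (eq_zero_of_herm_self hA P.2 hP) }, fun _ _ => rfl⟩

theorem herm_summand_eq_zero {A : GL (Fin 3) ℂ} (hA : ReducesToSquares Q A) {d k l : ℕ}
    (hk : 2 * k ≤ d) (hl : 2 * l ≤ d) (hkl : k ≠ l) {P T : Poly} (hP : P ∈ summand Q d k)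
    (hT : T ∈ summand Q d l) : herm Q A P T = 0 := by
  obtain ⟨p, hp, rfl⟩ := hP
  obtain ⟨t, ht, rfl⟩ := hT
  rw [LinearMap.mulLeft_apply, LinearMap.mulLeft_apply, herm_formPoly_pow_mul]
  exact herm_eq_zero_of_mem_Har hA (by omega) hp ht

theorem herm_mem_VQ_eq_zero (hB : IsUnit Q.toMatrix'.det) {A : GL (Fin 3) ℂ}
    (hA : ReducesToSquares Q A) {d : ℕ} {P T : Poly} (hP : P ∈ Har Q d) (hT : T ∈ VQ Q d) :
    herm Q A P T = 0 := by
  have hTd : T.IsHomogeneous d := hT.1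
  have hdvd : formPoly Q ∣ T := Ideal.mem_span_singleton.1 hT.2
  by_cases hd : d < 2
  · rw [eq_zero_of_formPoly_dvd_of_lt hTd hd hdvd, ← zero_smul ℂ (0 : Poly), herm_smul_right]
    simp
  · obtain ⟨e, rfl⟩ : ∃ e, d = e + 2 := ⟨d - 2, by omega⟩
    obtain ⟨S, hS, rfl⟩ := exists_homogeneous_of_formPoly_dvd hTd hdvd
    obtain ⟨h, hh, rfl⟩ := exists_harmonic_expansion hB e S hS
    rw [Finset.mul_sum, herm_sum_right hA]
    refine Finset.sum_eq_zero fun k _ => ?_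
    rw [show formPoly Q * (formPoly Q ^ k * h k) = formPoly Q ^ (k + 1) * h k by ring,
      ← one_mul P, ← pow_zero (formPoly Q), herm_formPoly_pow_mul]
    exact herm_eq_zero_of_mem_Har hA (by omega) hP (hh k)

theorem mem_Har_iff_herm_VQ (hB : IsUnit Q.toMatrix'.det) {A : GL (Fin 3) ℂ}
    (hA : ReducesToSquares Q A) {d : ℕ} {P : Poly} (hP : P ∈ V d) :
    P ∈ Har Q d ↔ ∀ T ∈ VQ Q d, herm Q A P T = 0 := by
  refine ⟨fun h T hT => herm_mem_VQ_eq_zero hB hA h hT, fun h => ?_⟩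
  by_cases hd : d < 2
  · exact ⟨hP, laplacian_eq_zero_of_lt Q hP hd⟩
  · obtain ⟨e, rfl⟩ : ∃ e, d = e + 2 := ⟨d - 2, by omega⟩
    obtain ⟨H, hH, R, hR, rfl⟩ := exists_harmonic_add_formPoly_mul hB hP
    have hQR : (formPoly Q * R).IsHomogeneous (e + 2) := by
      have := (isHomogeneous_formPoly Q).mul hR
      rwa [add_comm] at this
    have hmem : formPoly Q * R ∈ VQ Q (e + 2) :=
      ⟨hQR, Ideal.mem_span_singleton.2 (Dvd.intro _ rfl)⟩
    have h1 := h _ hmem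
    rw [herm_add_left hA, herm_mem_VQ_eq_zero hB hA hH hmem, zero_add] at h1
    rw [eq_zero_of_herm_self hA hQR h1, add_zero]
    exact hH

end QHarmonic

theorem theorem12 (Q : QuadraticForm ℂ (Fin 3 → ℂ))
    (hQ : LinearMap.Nondegenerate (QuadraticMap.associated (R := ℂ) Q)) :
    -- the direct sum decomposition of `V(d)`
    (∀ d : ℕ,
      iSupIndep (fun k : Fin (d / 2 + 1) => QHarmonic.summand Q d k) ∧
      (⨆ k : Fin (d / 2 + 1), QHarmonic.summand Q d k) = QHarmonic.V d) ∧
    -- its invariance under `O_Q(3; ℂ)`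
    (∀ d : ℕ, ∀ U ∈ QHarmonic.orthogonalGroup Q, ∀ k : Fin (d / 2 + 1),
      (QHarmonic.summand Q d k).map (QHarmonic.substMatrix U).toLinearMap =
        QHarmonic.summand Q d k) ∧
    -- the Hermitian product over the ellipsoid, for every reduction of `Q` to a sum of squares
    (∃ A : GL (Fin 3) ℂ, QHarmonic.ReducesToSquares Q A) ∧
    (∀ A : GL (Fin 3) ℂ, QHarmonic.ReducesToSquares Q A → ∀ d : ℕ,
      (∃ ip : InnerProductSpace.Core ℂ (QHarmonic.V d),
        ∀ P T : QHarmonic.V d, ip.inner T P = QHarmonic.herm Q A P T) ∧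
      (∀ k l : Fin (d / 2 + 1), k ≠ l →
        ∀ P ∈ QHarmonic.summand Q d k, ∀ T ∈ QHarmonic.summand Q d l,
          QHarmonic.herm Q A P T = 0) ∧
      (∀ P ∈ QHarmonic.V d,
        P ∈ QHarmonic.Har Q d ↔ ∀ T ∈ QHarmonic.VQ Q d, QHarmonic.herm Q A P T = 0)) ∧
    -- polynomial functions on `{Q = c}` are restrictions of `Q`-harmonic polynomials
    (∀ (c : ℂ) (F : QHarmonic.Poly), ∃ P : QHarmonic.Poly,
      QHarmonic.laplacian Q P = 0 ∧
      ∀ v ∈ QHarmonic.surface Q c, MvPolynomial.eval v P = MvPolynomial.eval v F) ∧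
    -- the Dirichlet problem
    (∀ (c : ℂ) (M N : QHarmonic.Poly), ∃! P : QHarmonic.Poly,
      QHarmonic.laplacian Q P = M ∧
      ∀ v ∈ QHarmonic.surface Q c, MvPolynomial.eval v P = MvPolynomial.eval v N) ∧
    -- the Maxwell representation; a multipole without vectors is a scalar `a`
    (∀ d : ℕ, ∀ P ∈ QHarmonic.V d,
      ∃ (a : ℂ) (u : (k : ℕ) → Fin (d - 2 * k) → QHarmonic.C3),
        ∀ (Ω : Set QHarmonic.C3) (r : QHarmonic.C3 → ℂ), QHarmonic.IsSqrtBranch Q Ω r →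
          ∀ v ∈ Ω, MvPolynomial.eval v P =
            ∑ k ∈ Finset.range (d / 2 + 1),
              (if 2 * k = d then a else 1) * r v ^ (2 * (d - k) + 1) *
                QHarmonic.iterDirDeriv (List.ofFn (u k)) (fun w => (r w)⁻¹) v) := by
  have hB := QHarmonic.isUnit_det_toMatrix' hQ
  obtain ⟨A, hA⟩ := QHarmonic.exists_reducesToSquares hQ
  refine ⟨fun d => ⟨QHarmonic.iSupIndep_summand hB d, QHarmonic.iSup_summand hB d⟩,
    fun d U hU k => QHarmonic.map_summand hU d k, ⟨A, hA⟩, fun A hA d => ⟨?_, ?_, ?_⟩, ?_,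
    QHarmonic.existsUnique_dirichlet hB hA, fun d P hP => QHarmonic.exists_maxwell hB hA hP⟩
  · exact QHarmonic.exists_innerProductCore hA d
  · exact fun k l hkl P hP T hT => QHarmonic.herm_summand_eq_zero hA (by omega) (by omega)
      (fun h => hkl (Fin.ext h)) hP hT
  · exact fun P hP => QHarmonic.mem_Har_iff_herm_VQ hB hA hP
  · exact fun c F => (QHarmonic.existsUnique_dirichlet hB hA c 0 F).exists
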